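/- **Definitions.** Let $X$ be a real Banach space and $T:X\to X$ a bounded linear operator. "Increasing" means strictly increasing. * A vector $x\in X$ is *hypercyclic* for $T$ if $\{T^nx:n\ge 0\}$ is dense in $X$, and *recurrent* for $T$ if $T^{k_n}x\to x$ for some increasing sequence $(k_n)_{n}$ of natural numbers. An operator is *hypercyclic* if it has a hypercyclic vector. * $T$ is *weakly-mixing* if for every $N\ge 1$ the $N$-fold direct sum $T\oplus\cdots\oplus T$ on $X\oplus\cdots\oplus X$ is hypercyclic. $T$ is *quasi-rigid* if there are an increasing sequence $(k_n)_n$ of natural numbers and a dense set $Y\subset X$ with $T^{k_n}x\to x$ for all $x\in Y$. * A *hypercyclic* (resp. *recurrent*) *subspace* for $T$ is an infinite-dimensional closed subspace $Z\subset X$ such that every $x\in Z\setminus\{0\}$ is hypercyclic (resp. every $x\in Z$ is recurrent) for $T$. * The *complexification* $\widetilde X=\{x+iy:x,y\in X\}$ is the complex Banach space with $(a+ib)(x+iy)=(ax-by)+i(ay+bx)$ and norm $\|x+iy\|_c=\sup_{t\in[0,2\pi]}\|\cos(t)x-\sin(t)y\|$, and $\widetilde T(x+iy)=Tx+iTy$.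 * For a bounded operator $S$ on a complex Banach space $V$, the *essential spectrum* $\sigma_e(S)$ is the set of $\lambda\in\mathbb C$ such that the class of $S-\lambda$ is not invertible in the Calkin algebra $\mathcal L(V)/\mathcal K(V)$ of bounded operators modulo compact operators. **Theorem.** Let $X$ be a real separable Banach space and let $T:X\to X$ be a bounded linear operator. (a) If $T$ is weakly-mixing, then the following statements are equivalent: 1. $T$ has a hypercyclic subspace; 2. there exist an infinite-dimensional closed subspace $E\subset X$ and an increasing sequence of natural numbers $(l_n)_n$ such that $T^{l_n}x\to 0$ for all $x\in E$; 3. there exist an infinite-dimensional closed subspace $E\subset X$ and an increasing sequence of natural numbers $(l_n)_n$ such that $\sup_n\|T^{l_n}|_E\|<\infty$; 4. $\sigma_e(\widetilde T)\cap\{\lambda\in\mathbb C:|\lambda|\le 1\}\neq\varnothing$. (b) If $T$ is quasi-rigid, then the following statements are equivalent: 1. $T$ has a recurrent subspace; 2. there exist an infinite-dimensional closed subspace $E\subset X$ and an increasing sequence of natural numbers $(l_n)_n$ such that $T^{l_n}x\to x$ for all $x\in E$; 3. there exist an infinite-dimensional closed subspace $E\subset X$ and an increasing sequence of natural numbers $(l_n)_n$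 such that $\sup_n\|T^{l_n}|_E\|<\infty$; 4. $\sigma_e(\widetilde T)\cap\{\lambda\in\mathbb C:|\lambda|\le 1\}\neq\varnothing$. -/

import Mathlib

open Filter Topology

noncomputable section

namespace LinDyn

/-! ### Linear dynamics -/

section Dynamics

variable {E : Type*} [NormedAddCommGroup E] [NormedSpace ℝ E]

/-- `x` is a hypercyclic vector for `T`: its orbit `{T ^ n x : n ≥ 0}` is dense. -/
def IsHypercyclicVector (T : E →L[ℝ] E) (x : E) : Prop :=
  Dense (Set.range fun n : ℕ => (T ^ n) x)

/-- `T` is hypercyclic: it has a hypercyclic vector. -/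
def IsHypercyclic (T : E →L[ℝ] E) : Prop :=
  ∃ x : E, IsHypercyclicVector T x

/-- `x` is a recurrent vector for `T`: `T ^ (k n) x → x` for some increasing sequence `k`. -/
def IsRecurrentVector (T : E →L[ℝ] E) (x : E) : Prop :=
  ∃ k : ℕ → ℕ, StrictMono k ∧ Tendsto (fun n => (T ^ k n) x) atTop (𝓝 x)

/-- The `N`-fold direct sum `T ⊕ ⋯ ⊕ T` acting on `E ⊕ ⋯ ⊕ E`. -/
def directSumPower (T : E →L[ℝ] E) (N : ℕ) : (Fin N → E) →L[ℝ] (Fin N → E) :=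
  ContinuousLinearMap.piMap fun _ => T

/-- `T` is weakly mixing: every `N`-fold direct sum `T ⊕ ⋯ ⊕ T`, `N ≥ 1`, is hypercyclic. -/
def IsWeaklyMixing (T : E →L[ℝ] E) : Prop :=
  ∀ N : ℕ, 1 ≤ N → IsHypercyclic (directSumPower T N)

/-- `T` is quasi-rigid: there are an increasing sequence `k` and a dense set `Y` such that
`T ^ (k n) x → x` for all `x ∈ Y`. -/
def IsQuasiRigid (T : E →L[ℝ] E) : Prop :=
  ∃ k : ℕ → ℕ, StrictMono k ∧ ∃ Y : Set E, Dense Y ∧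
    ∀ x ∈ Y, Tendsto (fun n => (T ^ k n) x) atTop (𝓝 x)

/-- `Z` is an infinite-dimensional closed subspace. -/
def IsInfDimClosed (Z : Submodule ℝ E) : Prop :=
  IsClosed (Z : Set E) ∧ ¬ FiniteDimensional ℝ Z

/-- `T` has a hypercyclic subspace: an infinite-dimensional closed subspace all of whose nonzero
vectors are hypercyclic for `T`. -/
def HasHypercyclicSubspace (T : E →L[ℝ] E) : Prop :=
  ∃ Z : Submodule ℝ E, IsInfDimClosed Z ∧ ∀ x ∈ Z, x ≠ 0 → IsHypercyclicVector T x

/-- `T` has a recurrent subspace: an infinite-dimensional closed subspace all of whose vectors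
are recurrent for `T`. -/
def HasRecurrentSubspace (T : E →L[ℝ] E) : Prop :=
  ∃ Z : Submodule ℝ E, IsInfDimClosed Z ∧ ∀ x ∈ Z, IsRecurrentVector T x

end Dynamics

/-! ### The Calkin algebra and the essential spectrum -/

section Essential

variable (E : Type*) [NormedAddCommGroup E] [NormedSpace ℂ E]

/-- The ideal of compact operators in the algebra of bounded operators on `E`. -/
def compactIdeal : Ideal (E →L[ℂ] E) where
  carrier := {K | IsCompactOperator K}
  zero_mem' := isCompactOperator_zero
  add_mem' := fun hf hg => IsCompactOperator.add hf hg
  smul_mem' := fun S _ hK => IsCompactOperator.clm_comp hK S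

instance : (compactIdeal E).IsTwoSided where
  mul_mem_of_left {_} S hK := IsCompactOperator.comp_clm hK S

/-- The Calkin algebra: bounded operators modulo compact operators. -/
abbrev Calkin : Type _ := (E →L[ℂ] E) ⧸ compactIdeal E

variable {E}

/-- The essential spectrum of `T`: the complex numbers `z` for which the class of `T - z` is not
invertible in the Calkin algebra. -/
def essentialSpectrum (T : E →L[ℂ] E) : Set ℂ :=
  {z | ¬ IsUnit (Ideal.Quotient.mk (compactIdeal E) (T - z • 1) : Calkin E)}

end Essential

/-! ### Complexification of a real normed space -/

/-- The complexification of a real vector space `X`: formal sums `re + i im` with `re, im ∈ X`. -/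
@[ext]
structure Complexification (X : Type*) where
  re : X
  im : X

namespace Complexification

variable {X : Type*} [NormedAddCommGroup X]

instance : Zero (Complexification X) := ⟨⟨0, 0⟩⟩
instance : Add (Complexification X) := ⟨fun z w => ⟨z.re + w.re, z.im + w.im⟩⟩
instance : Neg (Complexification X) := ⟨fun z => ⟨-z.re, -z.im⟩⟩
instance : Sub (Complexification X) := ⟨fun z w => ⟨z.re - w.re, z.im - w.im⟩⟩

@[simp] lemma zero_re : (0 : Complexification X).re = 0 := rfl
@[simp] lemma zero_im : (0 : Complexification X).im = 0 := rfl
@[simp] lemma add_re (z w : Complexification X) : (z + w).re = z.re + w.re := rfl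
@[simp] lemma add_im (z w : Complexification X) : (z + w).im = z.im + w.im := rfl
@[simp] lemma neg_re (z : Complexification X) : (-z).re = -z.re := rfl
@[simp] lemma neg_im (z : Complexification X) : (-z).im = -z.im := rfl
@[simp] lemma sub_re (z w : Complexification X) : (z - w).re = z.re - w.re := rfl
@[simp] lemma sub_im (z w : Complexification X) : (z - w).im = z.im - w.im := rfl

instance : AddCommGroup (Complexification X) where
  add_assoc a b c := by ext <;> simp [add_assoc]
  zero_add a := by ext <;> simp
  add_zero a := by ext <;> simp
  add_comm a b := by ext <;> simp [add_comm]
  neg_add_cancel a := by ext <;> simp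
  sub_eq_add_neg a b := by ext <;> simp [sub_eq_add_neg]
  nsmul := nsmulRec
  zsmul := zsmulRec

variable [NormedSpace ℝ X]

/-- `(a + ib)(x + iy) = (ax - by) + i(ay + bx)`. -/
instance : SMul ℂ (Complexification X) :=
  ⟨fun c z => ⟨c.re • z.re - c.im • z.im, c.re • z.im + c.im • z.re⟩⟩

@[simp] lemma smul_re (c : ℂ) (z : Complexification X) :
    (c • z).re = c.re • z.re - c.im • z.im := rfl
@[simp] lemma smul_im (c : ℂ) (z : Complexification X) :
    (c • z).im = c.re • z.im + c.im • z.re := rfl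

instance : Module ℂ (Complexification X) where
  one_smul z := by ext <;> simp
  mul_smul a b z := by
    ext <;> simp only [smul_re, smul_im, Complex.mul_re, Complex.mul_im] <;> module
  smul_zero a := by ext <;> simp
  smul_add a z w := by ext <;> simp only [smul_re, smul_im, add_re, add_im] <;> module
  add_smul a b z := by
    ext <;> simp only [smul_re, smul_im, add_re, add_im, Complex.add_re, Complex.add_im] <;> module
  zero_smul z := by ext <;> simp

/-- `‖x + iy‖ = sup {‖cos t • x - sin t • y‖ : t ∈ [0, 2π]}`. -/
instance : Norm (Complexification X) :=
  ⟨fun z => ⨆ t : Set.Icc (0 : ℝ) (2 * Real.pi),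
    ‖Real.cos t • z.re - Real.sin t • z.im‖⟩

lemma norm_def (z : Complexification X) :
    ‖z‖ = ⨆ t : Set.Icc (0 : ℝ) (2 * Real.pi), ‖Real.cos t • z.re - Real.sin t • z.im‖ := rfl

lemma norm_rotate_le_add (z : Complexification X) (t : ℝ) :
    ‖Real.cos t • z.re - Real.sin t • z.im‖ ≤ ‖z.re‖ + ‖z.im‖ := by
  refine (norm_sub_le _ _).trans ?_
  rw [norm_smul, norm_smul]
  exact add_le_add
    (mul_le_of_le_one_left (norm_nonneg _) (Real.abs_cos_le_one t))
    (mul_le_of_le_one_left (norm_nonneg _) (Real.abs_sin_le_one t))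

lemma norm_rotate_le (z : Complexification X) (t : ℝ) :
    ‖Real.cos t • z.re - Real.sin t • z.im‖ ≤ ‖z‖ := by
  have hs := toIcoMod_mem_Ico' Real.two_pi_pos t
  set n := toIcoDiv Real.two_pi_pos 0 t with hn
  have hst : toIcoMod Real.two_pi_pos 0 t = t - n * (2 * Real.pi) := by
    rw [← self_sub_toIcoDiv_zsmul, ← hn, zsmul_eq_mul]
  rw [hst] at hs
  have hb : BddAbove (Set.range fun t : Set.Icc (0 : ℝ) (2 * Real.pi) =>
      ‖Real.cos t • z.re - Real.sin t • z.im‖) :=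
    ⟨‖z.re‖ + ‖z.im‖, by rintro _ ⟨t, rfl⟩; exact norm_rotate_le_add z t⟩
  have h := le_ciSup hb ⟨t - n * (2 * Real.pi), hs.1, hs.2.le⟩
  rw [norm_def]
  refine le_trans (le_of_eq ?_) h
  rw [Real.cos_sub_int_mul_two_pi, Real.sin_sub_int_mul_two_pi]

lemma norm_le_of_forall {z : Complexification X} {C : ℝ}
    (h : ∀ t : ℝ, ‖Real.cos t • z.re - Real.sin t • z.im‖ ≤ C) : ‖z‖ ≤ C := by
  have : Nonempty (Set.Icc (0 : ℝ) (2 * Real.pi)) := ⟨⟨0, le_rfl, Real.two_pi_pos.le⟩⟩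
  exact ciSup_le fun t => h t

lemma norm_re_le (z : Complexification X) : ‖z.re‖ ≤ ‖z‖ := by
  simpa using norm_rotate_le z 0

lemma norm_im_le (z : Complexification X) : ‖z.im‖ ≤ ‖z‖ := by
  simpa using norm_rotate_le z (Real.pi / 2)

lemma norm_smul_le' (c : ℂ) (z : Complexification X) : ‖c • z‖ ≤ ‖c‖ * ‖z‖ := by
  refine norm_le_of_forall fun t => ?_
  have h1 : c.re = ‖c‖ * Real.cos c.arg := (Complex.norm_mul_cos_arg c).symm
  have h2 : c.im = ‖c‖ * Real.sin c.arg := (Complex.norm_mul_sin_arg c).symm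
  have : Real.cos t • (c • z).re - Real.sin t • (c • z).im =
      ‖c‖ • (Real.cos (t + c.arg) • z.re - Real.sin (t + c.arg) • z.im) := by
    rw [smul_re, smul_im, Real.cos_add, Real.sin_add]
    generalize Real.cos c.arg = a at *
    generalize Real.sin c.arg = b at *
    rw [h1, h2]
    module
  rw [this, norm_smul, norm_norm]
  exact mul_le_mul_of_nonneg_left (norm_rotate_le z _) (norm_nonneg _)

lemma normedSpaceCore : NormedSpace.Core ℂ (Complexification X) where
  norm_nonneg z := (norm_nonneg z.re).trans (norm_re_le z)
  norm_smul c z := by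
    refine le_antisymm (norm_smul_le' c z) ?_
    rcases eq_or_ne c 0 with rfl | hc
    · simpa using (norm_nonneg _).trans (norm_re_le ((0 : ℂ) • z))
    · have h := norm_smul_le' c⁻¹ (c • z)
      rw [smul_smul, inv_mul_cancel₀ hc, one_smul, norm_inv] at h
      rwa [← le_inv_mul_iff₀ (norm_pos_iff.mpr hc)]
  norm_triangle z w := by
    refine norm_le_of_forall fun t => ?_
    have : Real.cos t • (z + w).re - Real.sin t • (z + w).im =
        (Real.cos t • z.re - Real.sin t • z.im) + (Real.cos t • w.re - Real.sin t • w.im) := by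
      simp only [add_re, add_im]; module
    rw [this]
    exact (norm_add_le _ _).trans (add_le_add (norm_rotate_le z t) (norm_rotate_le w t))
  norm_eq_zero_iff z := by
    constructor
    · intro h
      ext
      · exact norm_le_zero_iff.mp (h ▸ norm_re_le z)
      · exact norm_le_zero_iff.mp (h ▸ norm_im_le z)
    · rintro rfl
      refine le_antisymm (norm_le_of_forall fun t => by simp) ?_
      exact (norm_nonneg _).trans (norm_re_le (0 : Complexification X))

instance : NormedAddCommGroup (Complexification X) := NormedAddCommGroup.ofCore normedSpaceCore

instance : NormedSpace ℂ (Complexification X) := NormedSpace.ofCore normedSpaceCore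

/-- The complexification of `T`, given by `x + iy ↦ T x + i T y`. -/
def map (T : X →L[ℝ] X) : Complexification X →L[ℂ] Complexification X :=
  LinearMap.mkContinuous
    { toFun := fun z => ⟨T z.re, T z.im⟩
      map_add' := fun z w => by ext <;> simp
      map_smul' := fun c z => by ext <;> simp }
    ‖T‖ fun z => norm_le_of_forall fun t => by
      have : Real.cos t • T z.re - Real.sin t • T z.im =
          T (Real.cos t • z.re - Real.sin t • z.im) := by simp
      exact this ▸ T.le_opNorm_of_le (norm_rotate_le z t)

end Complexification

end LinDyn

end

/-! Everything passes through the essential spectrum. If it misses the closed unit disc, the class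
of the complexified operator in the Calkin algebra is invertible and its inverse has spectral radius
below one. Hence, modulo compact operators, the powers have left inverses of norm tending to zero,
so for each constant all large powers expand by that constant on subspaces of finite codimension. A
gliding construction (`exists_mem_tendsto_norm_atTop`) then finds in every infinite-dimensional
closed subspace a vector whose orbit tends to infinity in norm. This excludes hypercyclic and
recurrent subspaces, and bounded subsequences of powers.

Conversely, let z lie in the essential spectrum with modulus at most one. Weak mixing or
quasi-rigidity forbids nonzero eigenfunctionals for scalars of modulus below one, so z is a limit of
w for which the complexified operator minus w has dense range. If that operator minus z were bounded
below on a subspace of finite codimension, this density would make it Fredholm; hence approximate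
eigenvectors exist in every such subspace. Their real parts are vectors on which the powers stay
close to uniformly bounded operators (`exists_bounded_approx_of_approx_eigenvector`). Mazur's method
makes them a basic sequence, and a small perturbation into the dense set of good vectors yields a
closed subspace where a subsequence of powers converges to 0 or to the identity
(`exists_isInfDimClosed_tendsto`).

For hypercyclicity, Baire category supplies K with norm less than one such that suitable powers of
T, composed with K, approximate rank one operators. The image of the subspace under 1 + K is then a
hypercyclic subspace (`hasHypercyclicSubspace_of_criterion`). -/

noncomputable section

namespace LinDyn

/-! ### Finite-codimensional subspaces as common kernels of finitely many functionals. -/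

section Functionals

variable {X F : Type*} [NormedAddCommGroup X] [NormedSpace ℝ X]
  [NormedAddCommGroup F] [NormedSpace ℝ F]

lemma exists_unit_mem_of_finite {Z : Submodule ℝ X} (hZ : ¬ FiniteDimensional ℝ Z)
    {s : Set (StrongDual ℝ X)} (hs : s.Finite) :
    ∃ e ∈ Z, ‖e‖ = 1 ∧ ∀ f ∈ s, f e = 0 := by
  have := hs.to_subtype
  let φ : Z →ₗ[ℝ] (s → ℝ) := LinearMap.pi fun f => (f : StrongDual ℝ X).toLinearMap ∘ₗ Z.subtype
  have hφ : ¬ Function.Injective φ := fun h => hZ (FiniteDimensional.of_injective φ h)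
  obtain ⟨z, hz, hz0⟩ : ∃ z : Z, φ z = 0 ∧ z ≠ 0 := by
    by_contra! h
    exact hφ ((injective_iff_map_eq_zero φ).2 h)
  have hz1 : (z : X) ≠ 0 := by simpa using hz0
  refine ⟨(‖(z : X)‖)⁻¹ • (z : X), Z.smul_mem _ z.2, norm_smul_inv_norm hz1, fun f hf => ?_⟩
  have : f z = 0 := congrFun hz ⟨f, hf⟩
  simp [this]

/-- Norming functionals of a finite ε/2-net suffice: passing from a point to its net point costs ε/2
twice. -/
lemma exists_finite_norming {C : Set F} (hC : TotallyBounded C) {ε : ℝ} (hε : 0 < ε) :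
    ∃ s : Set (StrongDual ℝ F), s.Finite ∧ (∀ f ∈ s, ‖f‖ ≤ 1) ∧
      ∀ y ∈ C, ∃ f ∈ s, ‖y‖ - ε ≤ f y := by
  obtain ⟨t, ht, hCt⟩ := Metric.totallyBounded_iff.1 hC (ε / 2) (half_pos hε)
  choose g hg1 hg2 using fun y : F => exists_dual_vector'' ℝ y
  refine ⟨g '' t, ht.image g, ?_, fun y hy => ?_⟩
  · rintro _ ⟨y, -, rfl⟩
    exact hg1 y
  · obtain ⟨w, hw, hyw⟩ := Set.mem_iUnion₂.1 (hCt hy)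
    rw [Metric.mem_ball, dist_eq_norm] at hyw
    refine ⟨g w, ⟨w, hw, rfl⟩, ?_⟩
    have h1 : ‖g w (y - w)‖ ≤ ‖y - w‖ := by
      simpa using (g w).le_of_opNorm_le (hg1 w) (y - w)
    have h2 : g w w = ‖w‖ := by simpa using hg2 w
    have h3 : ‖y‖ ≤ ‖w‖ + ‖y - w‖ := by simpa using norm_add_le w (y - w)
    rw [map_sub, h2] at h1
    have := abs_le.1 (Real.norm_eq_abs _ ▸ h1)
    linarith [this.1]

/-- The image of the unit ball is almost normed by finitely many functionals, and composing these
with K gives the set. -/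
lemma exists_finite_norm_le_of_isCompactOperator {K : X →L[ℝ] F} (hK : IsCompactOperator K)
    {ε : ℝ} (hε : 0 < ε) :
    ∃ s : Set (StrongDual ℝ X), s.Finite ∧ ∀ x, (∀ f ∈ s, f x = 0) → ‖K x‖ ≤ ε * ‖x‖ := by
  obtain ⟨C, hC, hKC⟩ := hK.image_closedBall_subset_compact (f := K.toLinearMap) 1
  obtain ⟨s, hs, -, hsC⟩ := exists_finite_norming hC.totallyBounded hε
  refine ⟨(fun f : StrongDual ℝ F => f.comp K) '' s, hs.image _, fun x hx => ?_⟩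
  rcases eq_or_ne x 0 with rfl | hx0
  · simp
  have hn : 0 < ‖x‖ := norm_pos_iff.2 hx0
  obtain ⟨f, hf, hfx⟩ := hsC (K (‖x‖⁻¹ • x)) (hKC ⟨‖x‖⁻¹ • x, by
    rw [mem_closedBall_zero_iff]; exact (norm_smul_inv_norm hx0).le, rfl⟩)
  have h0 : f (K x) = 0 := hx _ ⟨f, hf, rfl⟩
  rw [map_smul, map_smul, h0, smul_zero, norm_smul, norm_inv, norm_norm] at hfx
  have : ‖x‖⁻¹ * ‖K x‖ ≤ ε := by linarith
  rw [inv_mul_le_iff₀ hn] at this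
  linarith

/-- Mazur's lemma, the source of the basic sequence: a functional norming u up to one half does not
see v, so it bounds u by u + v. -/
lemma exists_finite_norm_le_add (V : Submodule ℝ X) [FiniteDimensional ℝ V] :
    ∃ s : Set (StrongDual ℝ X), s.Finite ∧
      ∀ u ∈ V, ∀ v, (∀ f ∈ s, f v = 0) → ‖u‖ ≤ 2 * ‖u + v‖ := by
  have hC : IsCompact ((↑) '' Metric.sphere (0 : V) 1 : Set X) :=
    (isCompact_sphere _ _).image continuous_subtype_val
  obtain ⟨s, hs, hs1, hsC⟩ := exists_finite_norming hC.totallyBounded (half_pos one_pos)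
  refine ⟨s, hs, fun u hu v hv => ?_⟩
  rcases eq_or_ne u 0 with rfl | hu0
  · simp
  have hn : 0 < ‖u‖ := norm_pos_iff.2 hu0
  obtain ⟨f, hf, hfu⟩ := hsC (‖u‖⁻¹ • u) ⟨‖u‖⁻¹ • ⟨u, hu⟩, by
    rw [mem_sphere_zero_iff_norm]; exact norm_smul_inv_norm hu0, rfl⟩
  rw [map_smul, norm_smul, norm_inv, norm_norm, inv_mul_cancel₀ hn.ne', smul_eq_mul] at hfu
  have h1 : f (u + v) ≤ ‖u + v‖ := (le_abs_self _).trans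
    (by simpa using f.le_of_opNorm_le (hs1 f hf) (u + v))
  rw [map_add, hv f hf, add_zero] at h1
  have h2 : (1 : ℝ) / 2 ≤ ‖u‖⁻¹ * f u := by linarith
  rw [inv_mul_eq_div, le_div_iff₀ hn] at h2
  linarith

end Functionals

/-! ### Vectors with orbits tending to infinity. -/

section Growth

variable {X F : Type*} [NormedAddCommGroup X] [NormedSpace ℝ X]
  [NormedAddCommGroup F] [NormedSpace ℝ F]

lemma exists_mem_Ico_succ_of_strictMono {m : ℕ → ℕ} (hm : StrictMono m) {j n : ℕ} (h : m j ≤ n) :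
    ∃ i, j ≤ i ∧ m i ≤ n ∧ n < m (i + 1) := by
  have hex : ∃ i, n < m (i + 1) := ⟨n, (hm.id_le n).trans_lt (hm n.lt_succ_self)⟩
  classical
  have hi := Nat.find_spec hex
  have hji : j ≤ Nat.find hex := Nat.lt_succ_iff.1 (hm.lt_iff_lt.1 (h.trans_lt hi))
  refine ⟨Nat.find hex, hji, ?_, hi⟩
  rcases Nat.eq_zero_or_pos (Nat.find hex) with h0 | h0
  · rw [h0]
    rw [h0, Nat.le_zero] at hji
    rwa [hji] at h
  · obtain ⟨k, hk⟩ := Nat.exists_eq_succ_of_ne_zero h0.ne'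
    have := Nat.find_min hex (m := k) (by omega)
    rw [hk]
    exact not_lt.1 this

/-- If operators `A n` are bounded below, with constants tending to infinity, on subspaces of finite
codimension, then every infinite-dimensional closed subspace contains `x` with `‖A n x‖ → ∞`. -/
theorem exists_mem_tendsto_norm_atTop [CompleteSpace X] (A : ℕ → X →L[ℝ] F)
    (hA : ∀ C : ℝ, ∀ᶠ n in atTop, ∃ s : Set (StrongDual ℝ X), s.Finite ∧
      ∀ x, (∀ f ∈ s, f x = 0) → C * ‖x‖ ≤ ‖A n x‖)
    {Z : Submodule ℝ X} (hZ : IsInfDimClosed Z) :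
    ∃ x ∈ Z, Tendsto (fun n => ‖A n x‖) atTop atTop := by
  -- The vector of block j will carry weight 2^(-j), so its image has norm at least 2j. One of the
  -- two neighbouring partial sums then has image of norm at least j.
  obtain ⟨m, hm, hmA⟩ := extraction_forall_of_eventually
    fun j : ℕ => eventually_forall_ge_atTop.2 (hA (2 ^ j * (2 * j)))
  choose! S hSfin hS using hmA
  -- A state is a partial sum together with the functionals that all later increments must
  -- annihilate.
  let σ := {p : X × Set (StrongDual ℝ X) // p.1 ∈ Z ∧ p.2.Finite}
  have step : ∀ (j : ℕ) (p : σ), ∃ q : σ, p.1.2 ⊆ q.1.2 ∧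
      (∃ e, ‖e‖ = 1 ∧ (∀ f ∈ q.1.2, f e = 0) ∧ q.1.1 = p.1.1 + (1 / 2 : ℝ) ^ j • e ∧
        ∀ n, m j ≤ n → n < m (j + 1) → 2 ^ j * (2 * j) ≤ ‖A n e‖) ∧
      ∀ n < m (j + 1), ∃ g : StrongDual ℝ F, ‖g‖ ≤ 1 ∧ g (A n p.1.1) = ‖A n p.1.1‖ ∧
        g.comp (A n) ∈ q.1.2 := by
    rintro j ⟨⟨u, G⟩, hu, hG⟩
    choose g hg1 hg2 using fun n => exists_dual_vector'' ℝ (A n u)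
    let G₁ := G ∪ (⋃ n ∈ Set.Ico (m j) (m (j + 1)), S j n) ∪
      (fun n => (g n).comp (A n)) '' Set.Iio (m (j + 1))
    have hG₁ : G₁.Finite := (hG.union ((Set.finite_Ico _ _).biUnion
      fun n hn => hSfin j n hn.1)).union ((Set.finite_Iio _).image _)
    obtain ⟨e, heZ, he, heG⟩ := exists_unit_mem_of_finite hZ.2 hG₁
    refine ⟨⟨(u + (1 / 2 : ℝ) ^ j • e, G₁), Z.add_mem hu (Z.smul_mem _ heZ), hG₁⟩, ?_,
      ⟨e, he, heG, rfl, fun n hn hn' => ?_⟩, fun n hn => ⟨g n, hg1 n, by simpa using hg2 n, ?_⟩⟩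
    · exact fun f hf => Or.inl (Or.inl hf)
    · have := hS j n hn e fun f hf => heG f (Or.inl (Or.inr
        (Set.mem_biUnion (Set.mem_Ico.2 ⟨hn, hn'⟩) hf)))
      rwa [he, mul_one] at this
    · exact Or.inr ⟨n, hn, rfl⟩
  choose next hsub he hg using step
  choose e he1 heG heu hen using he
  let st : ℕ → σ := fun j => Nat.rec ⟨(0, ∅), Z.zero_mem, Set.finite_empty⟩ next j
  have hst : ∀ j, st (j + 1) = next j (st j) := fun j => rfl
  let u : ℕ → X := fun j => (st j).1.1
  have hmono : Monotone fun j => (st j).1.2 := monotone_nat_of_le_succ fun j => hsub j (st j)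
  have hu : ∀ j, u (j + 1) = u j + (1 / 2 : ℝ) ^ j • e j (st j) := fun j => heu j (st j)
  have hcauchy : CauchySeq u := by
    refine cauchySeq_of_le_geometric (1 / 2 : ℝ) 1 (by norm_num) fun j => ?_
    rw [hu, dist_self_add_right, norm_smul, he1]
    simp
  obtain ⟨x, hx⟩ := cauchySeq_tendsto_of_complete hcauchy
  -- The increment of step j is itself killed by the functionals added at that step, so their values
  -- are frozen at `u j` already.
  have hfix : ∀ j, ∀ f ∈ (st (j + 1)).1.2, f x = f (u j) := by
    intro j f hf
    have h1 : ∀ i, f (u (j + i)) = f (u j) := by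
      intro i
      induction i with
      | zero => rfl
      | succ i ih =>
        have hfe : f (e (j + i) (st (j + i))) = 0 :=
          heG (j + i) (st (j + i)) f (hmono (show j + 1 ≤ j + i + 1 by omega) hf)
        rw [← add_assoc, hu, map_add, map_smul, hfe, smul_zero, add_zero, ih]
    have h2 : Tendsto (fun i => f (u (j + i))) atTop (𝓝 (f x)) :=
      (f.continuous.tendsto x).comp (by simpa [add_comm] using (tendsto_add_atTop_iff_nat j).2 hx)
    simp only [h1] at h2
    exact tendsto_nhds_unique h2 tendsto_const_nhds
  -- A functional norming the image of the partial sum is frozen, so it takes the same value on the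
  -- image of the limit.
  have hle : ∀ j n, n < m (j + 1) → ‖A n (u j)‖ ≤ ‖A n x‖ := by
    intro j n hn
    obtain ⟨g, hg1, hg2, hgG⟩ := hg j (st j) n hn
    have h1 : g (A n x) = g (A n (u j)) := hfix j _ hgG
    rw [← hg2]
    change g (A n (u j)) ≤ _
    rw [← h1]
    exact (le_abs_self _).trans (by simpa using g.le_of_opNorm_le hg1 (A n x))
  refine ⟨x, hZ.1.mem_of_tendsto hx (Eventually.of_forall fun j => (st j).2.1), ?_⟩
  refine tendsto_atTop.2 fun b => ?_
  obtain ⟨j, hj⟩ := exists_nat_ge b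
  filter_upwards [eventually_ge_atTop (m j)] with n hn
  obtain ⟨i, hji, hin, hni⟩ := exists_mem_Ico_succ_of_strictMono hm hn
  have h1 := hle i n hni
  have h2 := hle (i + 1) n (hni.trans (hm (Nat.lt_succ_self _)))
  have h3 := hen i (st i) n hin hni
  have h4 : ‖A n ((1 / 2 : ℝ) ^ i • e i (st i))‖ ≤ ‖A n (u (i + 1))‖ + ‖A n (u i)‖ := by
    rw [show (1 / 2 : ℝ) ^ i • e i (st i) = u (i + 1) - u i by rw [hu]; abel, map_sub]
    exact norm_sub_le _ _
  rw [map_smul, norm_smul, norm_pow, show ‖(1 / 2 : ℝ)‖ = 1 / 2 by norm_num] at h4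
  have h5 : (1 / 2 : ℝ) ^ i * (2 ^ i * (2 * i)) ≤ (1 / 2 : ℝ) ^ i * ‖A n (e i (st i))‖ :=
    mul_le_mul_of_nonneg_left h3 (by positivity)
  rw [← mul_assoc, ← mul_pow] at h5
  norm_num at h5
  have : (j : ℝ) ≤ i := Nat.cast_le.2 hji
  linarith

end Growth

/-! ### The Calkin algebra as a Banach algebra, and powers of inverses in it. -/

section Calkin

variable (E : Type*) [NormedAddCommGroup E] [NormedSpace ℂ E] [CompleteSpace E]

instance isClosed_compactIdeal : IsClosed (compactIdeal E : Set (E →L[ℂ] E)) :=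
  isClosed_setOfPred_isCompactOperator

instance : NormedRing (Calkin E) :=
  { Submodule.Quotient.normedAddCommGroup (compactIdeal E),
    (inferInstance : Ring (Calkin E)) with
    norm_mul_le := fun x y => by
      refine le_of_forall_pos_le_add fun ε hε => ?_
      have hlim : Tendsto (fun δ : ℝ => (‖x‖ + δ) * (‖y‖ + δ)) (𝓝[>] 0) (𝓝 (‖x‖ * ‖y‖)) := by
        have : Continuous fun δ : ℝ => (‖x‖ + δ) * (‖y‖ + δ) := by fun_prop
        simpa using (this.tendsto 0).mono_left nhdsWithin_le_nhds
      obtain ⟨δ, hδ, hδ0⟩ := ((hlim.eventually_lt_const (lt_add_of_pos_right _ hε)).and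
        self_mem_nhdsWithin).exists
      obtain ⟨a, rfl, ha⟩ := Submodule.Quotient.norm_mk_lt x hδ0
      obtain ⟨b, rfl, hb⟩ := Submodule.Quotient.norm_mk_lt y hδ0
      calc _ ≤ ‖a * b‖ := Submodule.Quotient.norm_mk_le (S := compactIdeal E) (a * b)
        _ ≤ ‖a‖ * ‖b‖ := norm_mul_le a b
        _ ≤ _ := mul_le_mul ha.le hb.le (norm_nonneg _) ((norm_nonneg _).trans ha.le)
        _ ≤ _ := hδ.le }

instance : NormedAlgebra ℂ (Calkin E) :=
  { Submodule.Quotient.normedSpace (compactIdeal E) ℂ,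
    Ideal.Quotient.algebra ℂ with }

instance : CompleteSpace (Calkin E) :=
  Submodule.Quotient.completeSpace (compactIdeal E)

end Calkin

/-- In a complex Banach algebra, powers of an element whose spectrum lies in the open unit disc
tend to zero. -/
lemma tendsto_norm_pow_of_spectrum_subset {A : Type*} [NormedRing A] [NormedAlgebra ℂ A]
    [CompleteSpace A] {a : A} (ha : ∀ z ∈ spectrum ℂ a, ‖z‖ < 1) :
    Tendsto (fun n => ‖a ^ n‖) atTop (𝓝 0) := by
  rcases subsingleton_or_nontrivial A with h | h
  · simp [Subsingleton.elim _ (0 : A)]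
  have hr : spectralRadius ℂ a < (1 : NNReal) :=
    spectrum.spectralRadius_lt_of_forall_lt a fun z hz => by exact_mod_cast ha z hz
  obtain ⟨r, hr, hr1⟩ := ENNReal.lt_iff_exists_nnreal_btwn.1 hr
  -- Gelfand's formula: eventually the n-th power has norm at most r^n.
  have hlim := (spectrum.pow_nnnorm_pow_one_div_tendsto_nhds_spectralRadius a).eventually_lt_const hr
  have hr1' : r < 1 := by exact_mod_cast hr1
  refine squeeze_zero' (Eventually.of_forall fun n => norm_nonneg _) ?_
    (tendsto_pow_atTop_nhds_zero_of_lt_one r.2 hr1')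
  filter_upwards [hlim, eventually_gt_atTop 0] with n hn hn0
  have h1 : ((‖a ^ n‖₊ : ENNReal) ^ (1 / n : ℝ)) ^ (n : ℝ) ≤ (r : ENNReal) ^ (n : ℝ) :=
    ENNReal.rpow_le_rpow hn.le (Nat.cast_nonneg n)
  rw [← ENNReal.rpow_mul, one_div, inv_mul_cancel₀ (by positivity), ENNReal.rpow_one,
    ENNReal.rpow_natCast] at h1
  exact_mod_cast h1

/-- If the essential spectrum avoids the closed unit disc, then the powers of `T` have left inverses
modulo compact operators whose norms tend to zero. -/
theorem exists_tendsto_zero_isCompactOperator_sub {E : Type*} [NormedAddCommGroup E]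
    [NormedSpace ℂ E] [CompleteSpace E] {T : E →L[ℂ] E}
    (hT : ¬ (essentialSpectrum T ∩ Metric.closedBall (0 : ℂ) 1).Nonempty) :
    ∃ S : ℕ → E →L[ℂ] E, Tendsto (fun n => ‖S n‖) atTop (𝓝 0) ∧
      ∀ n, IsCompactOperator (S n * T ^ n - 1 : E →L[ℂ] E) := by
  set t : Calkin E := Ideal.Quotient.mk (compactIdeal E) T with ht
  have hspec : ∀ z ∈ spectrum ℂ t, 1 < ‖z‖ := by
    intro z hz
    by_contra h
    refine hT ⟨z, fun hu => hz ?_, by simpa using h⟩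
    rw [spectrum.mem_resolventSet_iff, ← IsUnit.neg_iff, neg_sub]
    exact hu
  have h0 : IsUnit t := by
    by_contra h
    have := hspec 0 ((spectrum.zero_mem_iff ℂ).2 h)
    simp at this
    linarith
  obtain ⟨w, hw⟩ := h0
  have hs : Tendsto (fun n => ‖((w⁻¹ : (Calkin E)ˣ) : Calkin E) ^ n‖) atTop (𝓝 0) := by
    refine tendsto_norm_pow_of_spectrum_subset fun z hz => ?_
    rcases eq_or_ne z 0 with rfl | hz0
    · simp
    have h1 := hspec z⁻¹ (by
      rw [← hw]
      have := (spectrum.inv_mem_iff (r := Units.mk0 z hz0) (a := w⁻¹)).1 hz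
      simpa using this)
    rw [norm_inv, one_lt_inv₀ (norm_pos_iff.2 hz0)] at h1
    exact h1
  -- Lift the powers of the inverse with norm loss at most 1/(n+1), which keeps the limit zero.
  choose S hS hSn using fun n : ℕ => Submodule.Quotient.norm_mk_lt
    (S := compactIdeal E) (((w⁻¹ : (Calkin E)ˣ) : Calkin E) ^ n) (Nat.one_div_pos_of_nat (α := ℝ) (n := n))
  refine ⟨S, squeeze_zero (fun n => norm_nonneg _) (fun n => (hSn n).le) ?_, fun n => ?_⟩
  · simpa using hs.add tendsto_one_div_add_atTop_nhds_zero_nat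
  · have h1 : Ideal.Quotient.mk (compactIdeal E) (S n * T ^ n - 1) = 0 := by
      rw [map_sub, map_mul, map_pow, map_one, ← ht, ← hw]
      change (Submodule.Quotient.mk (S n) : Calkin E) * _ - 1 = 0
      rw [hS, ← Units.val_pow_eq_pow_val, ← Units.val_pow_eq_pow_val, ← Units.val_mul, inv_pow,
        inv_mul_cancel, Units.val_one, sub_self]
    exact Ideal.Quotient.eq_zero_iff_mem.1 h1

/-! ### Real and imaginary parts, completeness, and powers on the complexification. -/

namespace Complexification

variable {X : Type*} [NormedAddCommGroup X] [NormedSpace ℝ X]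

lemma norm_le_add (z : Complexification X) : ‖z‖ ≤ ‖z.re‖ + ‖z.im‖ :=
  norm_le_of_forall (norm_rotate_le_add z)

lemma real_smul_re (r : ℝ) (z : Complexification X) : (r • z).re = r • z.re := by
  rw [show r • z = (r : ℂ) • z from rfl, smul_re, Complex.ofReal_re, Complex.ofReal_im, zero_smul,
    sub_zero]

lemma real_smul_im (r : ℝ) (z : Complexification X) : (r • z).im = r • z.im := by
  rw [show r • z = (r : ℂ) • z from rfl, smul_im, Complex.ofReal_re, Complex.ofReal_im, zero_smul,
    add_zero]

/-- The real part, as a continuous real-linear map. -/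
def reCLM : Complexification X →L[ℝ] X :=
  LinearMap.mkContinuous
    { toFun := re
      map_add' := fun _ _ => rfl
      map_smul' := real_smul_re } 1 fun z => by simpa using norm_re_le z

/-- The imaginary part, as a continuous real-linear map. -/
def imCLM : Complexification X →L[ℝ] X :=
  LinearMap.mkContinuous
    { toFun := im
      map_add' := fun _ _ => rfl
      map_smul' := real_smul_im } 1 fun z => by simpa using norm_im_le z

/-- The embedding `x ↦ x + i 0`. -/
def ofRealCLM : X →L[ℝ] Complexification X :=
  LinearMap.mkContinuous
    { toFun := fun x => ⟨x, 0⟩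
      map_add' := fun _ _ => by ext <;> simp
      map_smul' := fun r x => by ext <;> simp [real_smul_re, real_smul_im] } 1 fun x => by simpa using norm_le_add (⟨x, 0⟩ : Complexification X)

@[simp] lemma reCLM_apply (z : Complexification X) : reCLM z = z.re := rfl
@[simp] lemma imCLM_apply (z : Complexification X) : imCLM z = z.im := rfl
@[simp] lemma ofRealCLM_re (x : X) : (ofRealCLM x).re = x := rfl
@[simp] lemma ofRealCLM_im (x : X) : (ofRealCLM x).im = 0 := rfl

lemma norm_ofRealCLM (x : X) : ‖ofRealCLM x‖ = ‖x‖ :=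
  le_antisymm (by simpa using norm_le_add (ofRealCLM x)) (norm_re_le (ofRealCLM x))

lemma ofRealCLM_add_I_smul (x y : X) :
    ofRealCLM x + Complex.I • ofRealCLM y = (⟨x, y⟩ : Complexification X) := by
  ext <;> simp

instance [CompleteSpace X] : CompleteSpace (Complexification X) := by
  refine Metric.complete_of_cauchySeq_tendsto fun u hu => ?_
  obtain ⟨x, hx⟩ := cauchySeq_tendsto_of_complete ((reCLM (X := X)).uniformContinuous.comp_cauchySeq hu)
  obtain ⟨y, hy⟩ := cauchySeq_tendsto_of_complete ((imCLM (X := X)).uniformContinuous.comp_cauchySeq hu)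
  refine ⟨⟨x, y⟩, ?_⟩
  rw [tendsto_iff_norm_sub_tendsto_zero] at hx hy ⊢
  refine squeeze_zero (fun n => norm_nonneg _) (fun n => norm_le_add _) ?_
  simpa using hx.add hy

@[simp] lemma map_re (T : X →L[ℝ] X) (z : Complexification X) : (map T z).re = T z.re := rfl
@[simp] lemma map_im (T : X →L[ℝ] X) (z : Complexification X) : (map T z).im = T z.im := rfl

lemma map_pow_apply (T : X →L[ℝ] X) (n : ℕ) (z : Complexification X) :
    (map T ^ n) z = ⟨(T ^ n) z.re, (T ^ n) z.im⟩ := by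
  induction n with
  | zero => rfl
  | succ n ih =>
    rw [pow_succ', pow_succ', mul_apply_eq_comp, ih]
    rfl

lemma map_pow_ofRealCLM (T : X →L[ℝ] X) (n : ℕ) (x : X) :
    (map T ^ n) (ofRealCLM x) = ofRealCLM ((T ^ n) x) := by
  rw [map_pow_apply]
  ext <;> simp

end Complexification

/-! ### Essential spectrum off the closed disc forces escaping orbits. -/

section EssentialSpectrum

open Complexification hiding map

variable {X : Type*} [NormedAddCommGroup X] [NormedSpace ℝ X] [CompleteSpace X]

/-- If the essential spectrum avoids the closed unit disc, then every infinite-dimensional closed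
subspace contains a vector whose orbit tends to infinity. -/
theorem exists_mem_tendsto_norm_pow_atTop {T : X →L[ℝ] X}
    (hT : ¬ (essentialSpectrum (Complexification.map T) ∩ Metric.closedBall (0 : ℂ) 1).Nonempty)
    {Z : Submodule ℝ X} (hZ : IsInfDimClosed Z) :
    ∃ x ∈ Z, Tendsto (fun n => ‖(T ^ n) x‖) atTop atTop := by
  obtain ⟨S, hS, hK⟩ := exists_tendsto_zero_isCompactOperator_sub hT
  refine exists_mem_tendsto_norm_atTop (fun n => T ^ n) (fun C => ?_) hZ
  -- On a subspace of finite codimension the compact defect absorbs half of the norm of x. This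
  -- threshold for `S n` turns the other half into expansion by |C| + 1; the absolute value allows
  -- negative C.
  have hC : 0 < 1 / (2 * (|C| + 1)) := by positivity
  filter_upwards [hS.eventually_lt_const hC] with n hn
  let K : X →L[ℝ] Complexification X :=
    ((S n * Complexification.map T ^ n - 1).restrictScalars ℝ).comp ofRealCLM
  have hKc : IsCompactOperator K := (hK n).comp_clm (ofRealCLM (X := X))
  obtain ⟨s, hs, hsK⟩ := exists_finite_norm_le_of_isCompactOperator hKc (half_pos one_pos)
  refine ⟨s, hs, fun x hx => ?_⟩
  have h1 := hsK x hx
  have h2 : K x = S n (ofRealCLM ((T ^ n) x)) - ofRealCLM x := by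
    rw [← map_pow_ofRealCLM]; rfl
  have h3 : ‖S n (ofRealCLM ((T ^ n) x))‖ ≤ 1 / (2 * (|C| + 1)) * ‖(T ^ n) x‖ := by
    rw [← norm_ofRealCLM ((T ^ n) x)]
    exact (S n).le_of_opNorm_le hn.le _
  have h4 : ‖x‖ ≤ ‖S n (ofRealCLM ((T ^ n) x))‖ + ‖K x‖ := by
    rw [← norm_ofRealCLM x, h2]
    calc _ = ‖S n (ofRealCLM ((T ^ n) x)) - (S n (ofRealCLM ((T ^ n) x)) - ofRealCLM x)‖ := by
            rw [sub_sub_cancel]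
      _ ≤ _ := norm_sub_le _ _
  have h5 : (|C| + 1) * ‖x‖ ≤ ‖(T ^ n) x‖ := by
    have : ‖x‖ ≤ 2 * (1 / (2 * (|C| + 1)) * ‖(T ^ n) x‖) := by linarith
    have h6 : 2 * (1 / (2 * (|C| + 1)) * ‖(T ^ n) x‖) = ‖(T ^ n) x‖ / (|C| + 1) := by
      field_simp
    rw [h6, le_div_iff₀ (by positivity)] at this
    linarith
  refine le_trans (mul_le_mul_of_nonneg_right ?_ (norm_nonneg x)) h5
  linarith [le_abs_self C]

end EssentialSpectrum

lemma isClosed_map_of_norm_le {𝕜 V W : Type*} [NontriviallyNormedField 𝕜] [NormedAddCommGroup V]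
    [NormedSpace 𝕜 V] [CompleteSpace V] [NormedAddCommGroup W] [NormedSpace 𝕜 W]
    {N : Submodule 𝕜 V} (hN : IsClosed (N : Set V)) {S : V →L[𝕜] W}
    {c : ℝ} (hc : 0 < c) (hS : ∀ z ∈ N, c * ‖z‖ ≤ ‖S z‖) :
    IsClosed (N.map S.toLinearMap : Set W) := by
  have : CompleteSpace N := hN.completeSpace_coe
  have hanti : AntilipschitzWith (Real.toNNReal c⁻¹) (S.comp N.subtypeL) := by
    refine ContinuousLinearMap.antilipschitz_of_bound _ fun z => ?_
    rw [Real.coe_toNNReal _ (inv_nonneg.2 hc.le), ← div_eq_inv_mul, le_div_iff₀ hc, mul_comm]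
    exact hS z z.2
  have := hanti.isClosed_range (S.comp N.subtypeL).uniformContinuous
  convert this using 1
  ext y
  simp

/-! ### Fredholm operators and approximate eigenvectors. -/

section Fredholm

variable {V : Type*} [NormedAddCommGroup V] [NormedSpace ℂ V]

lemma isCompactOperator_of_finiteDimensional_range {K : V →L[ℂ] V}
    (hK : FiniteDimensional ℂ K.range) : IsCompactOperator K := by
  have : ProperSpace K.range := FiniteDimensional.proper ℂ K.range
  exact (isCompactOperator_of_locallyCompactSpace_dom K.rangeRestrict).clm_comp
    K.range.subtypeL

-- One half of Atkinson's theorem: a quasi-inverse modulo finite rank operators is an inverse modulo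
-- compact ones.
open LinearMap.FiniteRangeSetoid in
lemma isUnit_mk_of_isFredholm {S : V →L[ℂ] V} (hS : S.IsFredholm) :
    IsUnit (Ideal.Quotient.mk (compactIdeal V) S : Calkin V) := by
  obtain ⟨R, hl, hr⟩ := hS.exists_isQuasiInverse
  have key : ∀ A : V →L[ℂ] V, (A.toLinearMap ≈ LinearMap.id) →
      (Ideal.Quotient.mk (compactIdeal V) A : Calkin V) = 1 := by
    intro A hA
    rw [← map_one (Ideal.Quotient.mk (compactIdeal V)), Ideal.Quotient.eq]
    rw [equiv_iff_hasNoetherianRange, LinearMap.hasNoetherianRange_iff_range] at hA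
    have : FiniteDimensional ℂ (A - 1 : V →L[ℂ] V).range :=
      IsNoetherian.iff_fg.1 hA
    exact isCompactOperator_of_finiteDimensional_range this
  have h1 : (Ideal.Quotient.mk (compactIdeal V) R : Calkin V) *
      Ideal.Quotient.mk (compactIdeal V) S = 1 := by
    rw [← map_mul]; exact key _ hl
  have h2 : (Ideal.Quotient.mk (compactIdeal V) S : Calkin V) *
      Ideal.Quotient.mk (compactIdeal V) R = 1 := by
    rw [← map_mul]; exact key _ hr
  exact ⟨⟨_, _, h2, h1⟩, rfl⟩

/-- The range contains a closed subspace with finite-dimensional complement in it, so it is closed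
and, being dense, everything. The quotient by N then surjects onto the quotient by its image. -/
lemma finrank_quotient_map_le_of_denseRange {N : Submodule ℂ V} (hNfin : N.CoFG)
    {S : V →L[ℂ] V} (hM : IsClosed (N.map S.toLinearMap : Set V)) (hS : DenseRange S) :
    (N.map S.toLinearMap).CoFG ∧
      Module.finrank ℂ (V ⧸ N.map S.toLinearMap) ≤ Module.finrank ℂ (V ⧸ N) := by
  have hcl : IsClosed (Set.range S) :=
    LinearMap.isClosed_range_of_isClosed_map_of_finiteDimensional_quotient
      (f := S.toLinearMap) (s := N) hM
  have hsurj : Function.Surjective S := by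
    rw [← Set.range_eq_univ, ← hcl.closure_eq]
    exact hS.closure_eq
  let q : (V ⧸ N) →ₗ[ℂ] (V ⧸ N.map S.toLinearMap) :=
    N.mapQ _ S.toLinearMap (Submodule.le_comap_map _ _)
  have hq : Function.Surjective q := by
    intro y
    obtain ⟨y, rfl⟩ := Submodule.Quotient.mk_surjective _ y
    obtain ⟨z, rfl⟩ := hsurj y
    exact ⟨Submodule.Quotient.mk z, rfl⟩
  exact ⟨Module.Finite.of_surjective q hq, LinearMap.finrank_le_finrank_of_surjective hq⟩

variable [CompleteSpace V]

/-- The restriction to N is an isomorphism onto its image, and both subspaces are closed of finite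
codimension. -/
lemma isFredholm_of_norm_le {N : Submodule ℂ V} (hN : IsClosed (N : Set V)) (hNfin : N.CoFG)
    {S : V →L[ℂ] V} {c : ℝ} (hc : 0 < c) (hS : ∀ z ∈ N, c * ‖z‖ ≤ ‖S z‖)
    (hfin : (N.map S.toLinearMap).CoFG) : S.IsFredholm := by
  have hM := isClosed_map_of_norm_le hN hc hS
  have : CompleteSpace N := hN.completeSpace_coe
  have : CompleteSpace (N.map S.toLinearMap) := hM.completeSpace_coe
  have hmaps : Set.MapsTo S N (N.map S.toLinearMap) := fun z hz => ⟨z, hz, rfl⟩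
  refine .of_isInvertible_restrict hN hM hmaps ?_
  have hker : (S.restrict hmaps).ker = ⊥ := by
    rw [LinearMap.ker_eq_bot']
    intro z hz
    have h1 : S z = 0 := congrArg Subtype.val hz
    have h2 := hS z z.2
    rw [h1, norm_zero] at h2
    have h3 : ‖(z : V)‖ ≤ 0 := nonpos_of_mul_nonpos_right h2 hc
    simpa using h3
  have hrange : (S.restrict hmaps).range = ⊤ := by
    rw [LinearMap.range_eq_top]
    rintro ⟨_, z, hz, rfl⟩
    exact ⟨⟨z, hz⟩, rfl⟩
  exact ⟨ContinuousLinearEquiv.ofBijective _ hker hrange, rfl⟩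

/-- An operator which is bounded below on a closed subspace `N` of finite codimension and which is a
norm limit of operators with dense range maps `N` onto a subspace of finite codimension. -/
lemma coFG_map_of_denseRange {N : Submodule ℂ V} (hN : IsClosed (N : Set V)) (hNfin : N.CoFG)
    {S : V →L[ℂ] V} {c : ℝ} (hc : 0 < c) (hS : ∀ z ∈ N, c * ‖z‖ ≤ ‖S z‖)
    (hdense : ∀ δ > 0, ∃ S' : V →L[ℂ] V, ‖S' - S‖ < δ ∧ DenseRange S') :
    (N.map S.toLinearMap).CoFG := by
  have hM := isClosed_map_of_norm_le hN hc hS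
  set M := N.map S.toLinearMap with hMdef
  by_contra hfin
  set d := Module.finrank ℂ (V ⧸ N)
  -- One vector more than the codimension of N: for a nearby S' with dense range, some nonzero
  -- combination of them must lie in S'(N).
  obtain ⟨v, hv⟩ : ∃ v : Fin (d + 1) → V, LinearIndependent ℂ (M.mkQ ∘ v) := by
    have h1 : ((d + 1 : ℕ) : Cardinal) ≤ Module.rank ℂ (V ⧸ M) :=
      (Cardinal.natCast_lt_aleph0.le).trans (not_lt.1 fun h => hfin (Module.rank_lt_aleph0_iff.1 h))
    obtain ⟨w, hw⟩ := exists_linearIndependent_of_le_rank h1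
    choose v hv using fun i => Submodule.mkQ_surjective M (w i)
    exact ⟨v, by rwa [show M.mkQ ∘ v = w from funext hv]⟩
  let l : (Fin (d + 1) → ℂ) →ₗ[ℂ] V := Fintype.linearCombination ℂ v
  let L : (Fin (d + 1) → ℂ) →L[ℂ] V := l.toContinuousLinearMap
  have hker : LinearMap.ker (M.mkQ ∘ₗ l) = ⊥ := by
    rw [LinearMap.ker_eq_bot']
    intro a ha
    funext i
    refine Fintype.linearIndependent_iff.1 hv a ?_ i
    simpa [l, Fintype.linearCombination_apply] using ha
  have : IsClosed (M : Set V) := hM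
  obtain ⟨K, hK, hanti⟩ := (M.mkQ ∘ₗ l).exists_antilipschitzWith hker
  have hKpos : (0 : ℝ) < K := hK
  -- The first bound keeps S' bounded below by c/2 on N. The second makes that combination too small
  -- modulo M for the antilipschitz estimate.
  obtain ⟨S', hS', hS'd⟩ := hdense (min (c / 2) (c / 2 / (K * (‖L‖ + 1)))) (by positivity)
  have hS'c : ∀ z ∈ N, c / 2 * ‖z‖ ≤ ‖S' z‖ := by
    intro z hz
    have h1 := hS z hz
    have h2 : ‖(S' - S) z‖ ≤ c / 2 * ‖z‖ :=
      (S' - S).le_of_opNorm_le (hS'.le.trans (min_le_left _ _)) z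
    have h3 : ‖S z‖ ≤ ‖S' z‖ + ‖(S' - S) z‖ := by
      have := norm_sub_le (S' z) ((S' - S) z)
      simpa using this
    linarith
  obtain ⟨hfin', hrank⟩ := finrank_quotient_map_le_of_denseRange hNfin
    (isClosed_map_of_norm_le hN (half_pos hc) hS'c) hS'd
  obtain ⟨a, ha0, ha⟩ : ∃ a, a ≠ 0 ∧ ((N.map S'.toLinearMap).mkQ ∘ₗ l) a = 0 := by
    have h1 : Module.finrank ℂ (V ⧸ N.map S'.toLinearMap) <
        Module.finrank ℂ (Fin (d + 1) → ℂ) := by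
      rw [Module.finrank_fin_fun]
      omega
    obtain ⟨a, ha, ha0⟩ := Submodule.exists_mem_ne_zero_of_ne_bot
      (LinearMap.ker_ne_bot_of_finrank_lt (f := (N.map S'.toLinearMap).mkQ ∘ₗ l) h1)
    exact ⟨a, ha0, ha⟩
  obtain ⟨z, hz, hza⟩ : l a ∈ N.map S'.toLinearMap := by
    simpa using ha
  replace hza : S' z = L a := hza
  have h1 : ‖a‖ ≤ K * ‖M.mkQ (l a)‖ := by
    have := hanti.le_mul_dist a 0
    simpa using this
  have h2 : ‖M.mkQ (l a)‖ ≤ ‖S' - S‖ * ‖z‖ := by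
    have h3 : M.mkQ (l a) = M.mkQ ((S' - S) z) := by
      rw [← sub_eq_zero, ← map_sub, Submodule.mkQ_apply, Submodule.Quotient.mk_eq_zero]
      refine ⟨z, hz, ?_⟩
      change S z = L a - (S' - S) z
      rw [← hza]
      simp
    rw [h3]
    exact (Submodule.Quotient.norm_mk_le (S := M) _).trans ((S' - S).le_opNorm z)
  have h4 : c / 2 * ‖z‖ ≤ ‖L‖ * ‖a‖ := (hS'c z hz).trans (hza ▸ L.le_opNorm a)
  have ha1 : 0 < ‖a‖ := norm_pos_iff.2 ha0
  have h5 : ‖S' - S‖ * (K * (‖L‖ + 1)) < c / 2 := by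
    rw [← lt_div_iff₀ (by positivity)]
    exact hS'.trans_le (min_le_right _ _)
  have h6 : c / 2 * ‖a‖ ≤ ‖S' - S‖ * (K * (‖L‖ + 1)) * ‖a‖ := by
    calc c / 2 * ‖a‖ ≤ c / 2 * (K * (‖S' - S‖ * ‖z‖)) :=
          mul_le_mul_of_nonneg_left (h1.trans (mul_le_mul_of_nonneg_left h2 hKpos.le)) (by positivity)
      _ = K * ‖S' - S‖ * (c / 2 * ‖z‖) := by ring
      _ ≤ K * ‖S' - S‖ * ((‖L‖ + 1) * ‖a‖) := by
          refine mul_le_mul_of_nonneg_left (h4.trans ?_) (by positivity)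
          exact mul_le_mul_of_nonneg_right (by linarith) (norm_nonneg _)
      _ = _ := by ring
  exact absurd (lt_of_mul_lt_mul_right (h6.trans_lt (mul_lt_mul_of_pos_right h5 ha1)) ha1.le)
    (lt_irrefl _)

/-- Approximate eigenvectors in subspaces of finite codimension, for points of the essential spectrum
which are limits of points `μ` such that `T - μ` has dense range. -/
theorem exists_approx_eigenvector_of_mem_essentialSpectrum {T : V →L[ℂ] V} {z : ℂ}
    (hz : z ∈ essentialSpectrum T)
    (hdense : ∀ δ > 0, ∃ w : ℂ, ‖w - z‖ < δ ∧ DenseRange (T - w • 1 : V →L[ℂ] V))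
    {s : Set (StrongDual ℂ V)} (hs : s.Finite) {ε : ℝ} (hε : 0 < ε) :
    ∃ x : V, ‖x‖ = 1 ∧ (∀ f ∈ s, f x = 0) ∧ ‖T x - z • x‖ ≤ ε := by
  -- Otherwise T - z is bounded below on the common kernel of s, hence Fredholm by the dense-range
  -- approximation, against the choice of z.
  by_contra! hcon
  have := hs.to_subtype
  have := Fintype.ofFinite s
  let φ : V →L[ℂ] (s → ℂ) := ContinuousLinearMap.pi fun f => (f : StrongDual ℂ V)
  have hN : IsClosed (φ.ker : Set V) := φ.isClosed_ker
  have hNfin : φ.ker.CoFG :=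
    (LinearMap.quotKerEquivRange φ.toLinearMap).symm.finiteDimensional
  have hS : ∀ x ∈ φ.ker, ε * ‖x‖ ≤ ‖(T - z • 1 : V →L[ℂ] V) x‖ := by
    intro x hx
    rcases eq_or_ne x 0 with rfl | hx0
    · simp
    have hx1 : 0 < ‖x‖ := norm_pos_iff.2 hx0
    have hx2 : φ x = 0 := hx
    have h1 := hcon ((‖x‖⁻¹ : ℂ) • x) (by simp [norm_smul, hx1.ne']) fun f hf => by
      have : f x = 0 := congrFun hx2 ⟨f, hf⟩
      rw [map_smul, this, smul_zero]
    rw [map_smul, smul_comm, ← smul_sub, norm_smul, norm_inv, Complex.norm_real, norm_norm,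
      ← div_eq_inv_mul, lt_div_iff₀ hx1] at h1
    simpa using h1.le
  refine hz (isUnit_mk_of_isFredholm (isFredholm_of_norm_le hN hNfin hε hS
    (coFG_map_of_denseRange hN hNfin hε hS fun δ hδ => ?_)))
  obtain ⟨w, hw, hwd⟩ := hdense δ hδ
  refine ⟨T - w • 1, ?_, hwd⟩
  rw [sub_sub_sub_cancel_left, ← sub_smul]
  refine lt_of_le_of_lt ((norm_smul_le _ _).trans ?_) hw
  rw [norm_sub_rev]
  exact mul_le_of_le_one_right (norm_nonneg _) ContinuousLinearMap.norm_id_le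

end Fredholm

/-! ### From complex approximate eigenvectors to real vectors. -/

section ApproximateEigenvectors

open Complexification hiding map

variable {X : Type*} [NormedAddCommGroup X] [NormedSpace ℝ X]

/-- The real or the imaginary part of a unit vector has norm at least 1/2, and multiplication by -i
moves the latter into the real part. Complex-linear extensions of the functionals are insensitive to
this rotation. -/
lemma exists_half_le_norm_re_of_approx_eigenvector {T : X →L[ℝ] X} {c : ℂ}
    (h : ∀ s : Set (StrongDual ℂ (Complexification X)), s.Finite → ∀ ε > 0,
      ∃ z, ‖z‖ = 1 ∧ (∀ f ∈ s, f z = 0) ∧ ‖Complexification.map T z - c • z‖ ≤ ε)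
    {s : Set (StrongDual ℝ X)} (hs : s.Finite) {ε : ℝ} (hε : 0 < ε) :
    ∃ z : Complexification X, 1 / 2 ≤ ‖z.re‖ ∧ (∀ f ∈ s, f z.re = 0) ∧
      ‖Complexification.map T z - c • z‖ ≤ ε := by
  let ext : StrongDual ℝ X → StrongDual ℂ (Complexification X) := fun f =>
    StrongDual.extendRCLike (𝕜 := ℂ) (f.comp reCLM)
  have hext : ∀ (f : StrongDual ℝ X) z, ext f z = 0 → f z.re = 0 := by
    intro f z hz
    have h1 := congrArg Complex.re hz
    simpa [ext, StrongDual.extendRCLike_apply] using h1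
  obtain ⟨z, hz1, hzs, hz⟩ := h (ext '' s) (hs.image ext) ε hε
  rcases le_or_gt (1 / 2) ‖z.re‖ with hre | hre
  · exact ⟨z, hre, fun f hf => hext f z (hzs _ ⟨f, hf, rfl⟩), hz⟩
  · refine ⟨(-Complex.I) • z, ?_, fun f hf => hext f _ ?_, ?_⟩
    · have h1 := norm_le_add z
      have h2 : ((-Complex.I) • z).re = z.im := by simp
      rw [h2]
      linarith
    · rw [map_smul, hzs _ ⟨f, hf, rfl⟩, smul_zero]
    · rw [map_smul, smul_comm, ← smul_sub, norm_smul]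
      simpa using hz

lemma exists_forall_le_norm_pow_sub_le {V : Type*} [NormedAddCommGroup V] [NormedSpace ℂ V]
    (T : V →L[ℂ] V) (c : ℂ) (n : ℕ) :
    ∃ B > 0, ∀ m ≤ n, ∀ z, ‖(T ^ m) z - c ^ m • z‖ ≤ B * ‖T z - c • z‖ := by
  have hcomm : Commute T (c • 1 : V →L[ℂ] V) := (Commute.one_right T).smul_right c
  let G : ℕ → V →L[ℂ] V := fun m =>
    ∑ i ∈ Finset.range m, T ^ i * (c • 1 : V →L[ℂ] V) ^ (m - 1 - i)
  refine ⟨∑ m ∈ Finset.range (n + 1), ‖G m‖ + 1, by positivity, fun m hm z => ?_⟩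
  have h1 : (T ^ m) z - c ^ m • z = G m (T z - c • z) := by
    have := DFunLike.congr_fun (hcomm.geom_sum₂_mul m) z
    rw [smul_pow, one_pow] at this
    exact this.symm
  rw [h1]
  refine (G m).le_of_opNorm_le ?_ _
  have := Finset.single_le_sum (f := fun m => ‖G m‖) (fun i _ => norm_nonneg _)
    (Finset.mem_range.2 (Nat.lt_succ_of_le hm))
  linarith

/-- Approximate eigenvectors of the complexification, for an approximate eigenvalue in the closed
unit disc, yield real vectors on which the powers of `T` are approximated by bounded operators. -/
theorem exists_bounded_approx_of_approx_eigenvector {T : X →L[ℝ] X} {c : ℂ} (hc : ‖c‖ ≤ 1)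
    (h : ∀ s : Set (StrongDual ℂ (Complexification X)), s.Finite → ∀ ε > 0,
      ∃ z, ‖z‖ = 1 ∧ (∀ f ∈ s, f z = 0) ∧ ‖Complexification.map T z - c • z‖ ≤ ε) :
    ∃ (C : ℝ) (L : ℕ → X →L[ℝ] X), (∀ m, ‖L m‖ ≤ C) ∧
      ∀ s : Set (StrongDual ℝ X), s.Finite → ∀ (n : ℕ), ∀ ε > 0,
        ∃ x, ‖x‖ = 1 ∧ (∀ f ∈ s, f x = 0) ∧ ∀ m ≤ n, ‖(T ^ m) x - L m x‖ ≤ ε := by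
  have hpow : ∀ m, ‖c ^ m‖ ≤ 1 := fun m => by
    rw [norm_pow]; exact pow_le_one₀ (norm_nonneg _) hc
  have hre : ∀ m, |(c ^ m).re| ≤ 1 := fun m => (Complex.abs_re_le_norm _).trans (hpow m)
  have him : ∀ m, |(c ^ m).im / c.im| ≤ |c.im|⁻¹ := fun m => by
    rw [abs_div, div_eq_mul_inv]
    exact mul_le_of_le_one_left (by positivity) ((Complex.abs_im_le_norm _).trans (hpow m))
  -- For an exact eigenvector x + iy, the equation Tx = Re(c) x - Im(c) y eliminates y from the
  -- formula for T^m x. For real c, division by zero gives 0, which is correct since c^m is real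
  -- too.
  let L : ℕ → X →L[ℝ] X := fun m => (c ^ m).re • 1 + ((c ^ m).im / c.im) • (T - c.re • 1)
  refine ⟨1 + |c.im|⁻¹ * (‖T‖ + 1), L, fun m => ?_, fun s hs n ε hε => ?_⟩
  · have h1 : ‖(1 : X →L[ℝ] X)‖ ≤ 1 := ContinuousLinearMap.norm_id_le
    have h2 : ‖c.re • (1 : X →L[ℝ] X)‖ ≤ 1 := by
      rw [norm_smul, Real.norm_eq_abs]
      exact mul_le_one₀ ((Complex.abs_re_le_norm _).trans hc) (norm_nonneg _) h1
    refine (norm_add_le _ _).trans (add_le_add ?_ ?_)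
    · rw [norm_smul, Real.norm_eq_abs]
      exact mul_le_one₀ (hre m) (norm_nonneg _) h1
    · rw [norm_smul, Real.norm_eq_abs]
      exact mul_le_mul (him m) ((norm_sub_le _ _).trans (by linarith)) (norm_nonneg _)
        (by positivity)
  · obtain ⟨B, hB, hBz⟩ := exists_forall_le_norm_pow_sub_le (Complexification.map T) c n
    -- The factor 2 in the tolerance pays for normalizing a real part of norm at least 1/2.
    obtain ⟨z, hz1, hzs, hz⟩ := exists_half_le_norm_re_of_approx_eigenvector h hs
      (show 0 < ε / (2 * (B + |c.im|⁻¹)) by positivity)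
    have hz0 : 0 < ‖z.re‖ := by linarith
    refine ⟨‖z.re‖⁻¹ • z.re, norm_smul_inv_norm (norm_pos_iff.1 hz0), fun f hf => ?_,
      fun m hm => ?_⟩
    · rw [map_smul, hzs f hf, smul_zero]
    rw [map_smul, map_smul, ← smul_sub, norm_smul, norm_inv, norm_norm, ← div_eq_inv_mul,
      div_le_iff₀ hz0]
    have himm : (c ^ m).im = (c ^ m).im / c.im * c.im := by
      rcases eq_or_ne c.im 0 with h0 | h0
      · obtain ⟨r, rfl⟩ : ∃ r : ℝ, c = r := ⟨c.re, by apply Complex.ext <;> simp [h0]⟩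
        rw [← Complex.ofReal_pow, Complex.ofReal_im, zero_div, zero_mul]
      · rw [div_mul_cancel₀ _ h0]
    have key : (T ^ m) z.re - L m z.re =
        reCLM ((Complexification.map T ^ m) z - c ^ m • z) -
          ((c ^ m).im / c.im) • reCLM (Complexification.map T z - c • z) := by
      rw [map_pow_apply]
      simp only [reCLM_apply, sub_re, smul_re, map_re]
      change (T ^ m) z.re - ((c ^ m).re • z.re + ((c ^ m).im / c.im) • (T z.re - c.re • z.re)) = _
      nth_rewrite 2 [himm]
      module
    rw [key]
    calc _ ≤ B * ‖Complexification.map T z - c • z‖ +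
          |c.im|⁻¹ * ‖Complexification.map T z - c • z‖ := by
          refine (norm_sub_le _ _).trans (add_le_add ((norm_re_le _).trans (hBz m hm z)) ?_)
          rw [norm_smul, Real.norm_eq_abs]
          exact mul_le_mul (him m) (norm_re_le (Complexification.map T z - c • z)) (norm_nonneg _)
            (by positivity)
      _ = (B + |c.im|⁻¹) * ‖Complexification.map T z - c • z‖ := by ring
      _ ≤ (B + |c.im|⁻¹) * (ε / (2 * (B + |c.im|⁻¹))) :=
          mul_le_mul_of_nonneg_left hz (by positivity)
      _ = ε * (1 / 2) := by field_simp
      _ ≤ ε * ‖z.re‖ := mul_le_mul_of_nonneg_left hz1 hε.le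

/-- If `T` has no nonzero complex-valued eigenfunctional for `c`, then `T - c` has dense range in the
complexification. -/
lemma denseRange_map_sub_of_forall_eq_zero {T : X →L[ℝ] X} {c : ℂ}
    (h : ∀ g : X →L[ℝ] ℂ, (∀ x, g (T x) = c * g x) → g = 0) :
    DenseRange (Complexification.map T - c • 1 :
      Complexification X →L[ℂ] Complexification X) := by
  set S : Complexification X →L[ℂ] Complexification X := Complexification.map T - c • 1
  by_contra hd
  have hne : S.range.topologicalClosure ≠ ⊤ := fun ht => hd fun y => by
    have : y ∈ S.range.topologicalClosure := ht ▸ Submodule.mem_top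
    exact this
  obtain ⟨f, hf0, hf⟩ : ∃ f : StrongDual ℂ (Complexification X), f ≠ 0 ∧ ∀ z, f (S z) = 0 := by
    have hcl : IsClosed (S.range.topologicalClosure : Set (Complexification X)) :=
      S.range.isClosed_topologicalClosure
    obtain ⟨y, hy⟩ := SetLike.exists_not_mem_of_ne_top _ hne
    obtain ⟨g, hg⟩ := SeparatingDual.exists_ne_zero (R := ℂ)
      (x := S.range.topologicalClosure.mkQ y)
      (by rwa [Ne, Submodule.mkQ_apply, Submodule.Quotient.mk_eq_zero])
    refine ⟨g.comp S.range.topologicalClosure.mkQL, fun h0 => hg (DFunLike.congr_fun h0 y),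
      fun z => ?_⟩
    have h1 : S.range.topologicalClosure.mkQ (S z) = 0 := by
      rw [Submodule.mkQ_apply, Submodule.Quotient.mk_eq_zero]
      exact S.range.le_topologicalClosure ⟨z, rfl⟩
    change g (S.range.topologicalClosure.mkQ (S z)) = 0
    rw [h1, map_zero]
  apply hf0
  -- A functional vanishing on the range restricts to a complex-valued eigenfunctional on X, and it
  -- is determined by that restriction.
  have hg := h ((f.restrictScalars ℝ).comp ofRealCLM) fun x => by
    have := hf (ofRealCLM x)
    have h2 : S (ofRealCLM x) = ofRealCLM (T x) - c • ofRealCLM x := by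
      change Complexification.map T _ - c • _ = _
      congr 1
      ext <;> simp
    rw [h2, map_sub, map_smul, sub_eq_zero] at this
    exact this
  ext z
  have h1 : ∀ x, f (ofRealCLM x) = 0 := fun x => DFunLike.congr_fun hg x
  obtain ⟨x, y⟩ := z
  rw [← ofRealCLM_add_I_smul, map_add, map_smul, h1, h1]
  simp

end ApproximateEigenvectors

/-! ### Perturbed basic sequences and convergence on their closed span. -/

section BasicSequence

variable {X : Type*} [NormedAddCommGroup X] [NormedSpace ℝ X]

/-- Pointwise convergence of operators which are uniformly bounded on a subspace passes to the
closure of the subspace. -/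
lemma tendsto_of_mem_topologicalClosure {B : ℕ → X →L[ℝ] X} {A : X →L[ℝ] X} {E : Submodule ℝ X}
    {M : ℝ} (hM : ∀ n, ∀ u ∈ E, ‖B n u‖ ≤ M * ‖u‖)
    (h : ∀ u ∈ E, Tendsto (fun n => B n u) atTop (𝓝 (A u))) {x : X}
    (hx : x ∈ E.topologicalClosure) : Tendsto (fun n => B n x) atTop (𝓝 (A x)) := by
  have hM' : ∀ n, ∀ u ∈ E.topologicalClosure, ‖B n u‖ ≤ M * ‖u‖ := fun n u hu => by
    have hcl : IsClosed {u : X | ‖B n u‖ ≤ M * ‖u‖} :=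
      isClosed_le (by fun_prop) (by fun_prop)
    exact closure_minimal (fun v hv => hM n v hv) hcl hu
  rw [Metric.tendsto_atTop]
  intro ε hε
  have hlim : Tendsto (fun u => |M| * ‖x - u‖ + ‖A‖ * ‖u - x‖) (𝓝 x) (𝓝 0) := by
    have : Continuous fun u => |M| * ‖x - u‖ + ‖A‖ * ‖u - x‖ := by fun_prop
    simpa using this.tendsto x
  obtain ⟨u, hu, huE⟩ := ((hlim.eventually_lt_const (half_pos hε)).and_frequently
    (mem_closure_iff_frequently.1 hx)).exists
  obtain ⟨N, hN⟩ := Metric.tendsto_atTop.1 (h u huE) (ε / 2) (half_pos hε)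
  refine ⟨N, fun n hn => ?_⟩
  have h1 := hN n hn
  have h2 : ‖B n (x - u)‖ ≤ |M| * ‖x - u‖ :=
    (hM' n _ (E.topologicalClosure.sub_mem hx (E.le_topologicalClosure huE))).trans
      (mul_le_mul_of_nonneg_right (le_abs_self M) (norm_nonneg _))
  have h3 : ‖A (u - x)‖ ≤ ‖A‖ * ‖u - x‖ := A.le_opNorm _
  rw [dist_eq_norm] at h1 ⊢
  have h4 : B n x - A x = B n (x - u) + (B n u - A u) + A (u - x) := by
    simp only [map_sub]; abel
  rw [h4]
  refine (norm_add₃_le).trans_lt ?_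
  linarith

/-- A small perturbation `e` of a basic sequence `x` spans an infinite-dimensional closed subspace
on which the operators `B n` converge to `A`, provided that `B n` is close to `A` on `e j` for
`j < n` and close to a bounded operator on `e j` for `n ≤ j`. -/
lemma exists_isInfDimClosed_of_basicSequence {x e : ℕ → X} {ε : ℕ → ℝ} {B L : ℕ → X →L[ℝ] X}
    {A : X →L[ℝ] X} {C : ℝ} (hx : ∀ j, ‖x j‖ = 1)
    (hproj : ∀ (a : ℕ → ℝ) (n N : ℕ), n ≤ N →
      ‖∑ j ∈ Finset.range n, a j • x j‖ ≤ 2 * ‖∑ j ∈ Finset.range N, a j • x j‖)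
    (hε0 : ∀ j, 0 ≤ ε j) (hε : ∀ N, ∑ j ∈ Finset.range N, ε j ≤ 1 / 8)
    (hex : ∀ j, ‖e j - x j‖ ≤ ε j) (hL : ∀ n, ‖L n‖ ≤ C)
    (hBA : ∀ j n, j < n → ‖B n (e j) - A (e j)‖ ≤ ε j)
    (hBL : ∀ j n, n ≤ j → ‖B n (e j) - L n (x j)‖ ≤ ε j)
    (hlim : ∀ j, Tendsto (fun n => B n (e j)) atTop (𝓝 (A (e j)))) :
    ∃ E : Submodule ℝ X, IsInfDimClosed E ∧
      ∀ y ∈ E, Tendsto (fun n => B n y) atTop (𝓝 (A y)) := by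
  let P : (ℕ → ℝ) → ℕ → X := fun a n => ∑ j ∈ Finset.range n, a j • x j
  let U : (ℕ → ℝ) → ℕ → X := fun a n => ∑ j ∈ Finset.range n, a j • e j
  -- Each term is a difference of two partial sums, each at most twice the full sum.
  have hcoef : ∀ a N j, j < N → |a j| ≤ 4 * ‖P a N‖ := by
    intro a N j hj
    have h1 : a j • x j = P a (j + 1) - P a j := by simp [P, Finset.sum_range_succ]
    have h2 : |a j| = ‖a j • x j‖ := by rw [norm_smul, hx, mul_one, Real.norm_eq_abs]
    rw [h2, h1]
    linarith [norm_sub_le (P a (j + 1)) (P a j), hproj a (j + 1) N hj, hproj a j N hj.le]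
  have herr : ∀ (a : ℕ → ℝ) (N : ℕ) (J : Finset ℕ) (d : ℕ → X), J ⊆ Finset.range N →
      (∀ j ∈ J, ‖d j‖ ≤ ε j) → ‖∑ j ∈ J, a j • d j‖ ≤ ‖P a N‖ / 2 := by
    intro a N J d hJ hd
    calc _ ≤ ∑ j ∈ J, ‖a j • d j‖ := norm_sum_le _ _
      _ ≤ ∑ j ∈ J, 4 * ‖P a N‖ * ε j := Finset.sum_le_sum fun j hj => by
          rw [norm_smul, Real.norm_eq_abs]
          exact mul_le_mul (hcoef a N j (Finset.mem_range.1 (hJ hj))) (hd j hj) (norm_nonneg _)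
            (by positivity)
      _ ≤ ∑ j ∈ Finset.range N, 4 * ‖P a N‖ * ε j :=
          Finset.sum_le_sum_of_subset_of_nonneg hJ fun j _ _ => mul_nonneg (by positivity) (hε0 j)
      _ = 4 * ‖P a N‖ * ∑ j ∈ Finset.range N, ε j := by rw [Finset.mul_sum]
      _ ≤ 4 * ‖P a N‖ * (1 / 8) := mul_le_mul_of_nonneg_left (hε N) (by positivity)
      _ = _ := by ring
  have hUP : ∀ a n N, n ≤ N → ‖U a n - P a n‖ ≤ ‖P a N‖ / 2 := by
    intro a n N hn
    have h1 : U a n - P a n = ∑ j ∈ Finset.range n, a j • (e j - x j) := by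
      simp [U, P, smul_sub]
    rw [h1]
    exact herr a N _ _ (Finset.range_subset_range.2 hn) fun j _ => hex j
  have hPU : ∀ a N, ‖P a N‖ ≤ 2 * ‖U a N‖ := by
    intro a N
    have h1 := hUP a N N le_rfl
    have h2 : ‖P a N‖ ≤ ‖U a N‖ + ‖U a N - P a N‖ := by
      have := norm_sub_le (U a N) (U a N - P a N)
      rwa [sub_sub_cancel] at this
    linarith
  have hC : 0 ≤ C := (norm_nonneg _).trans (hL 0)
  -- Split at n: before it `B n` acts almost like A, from it on almost like `L n`. Bounded basis
  -- projections control both pieces independently of n.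
  have hB : ∀ a N n, ‖B n (U a N)‖ ≤ 2 * (1 + 3 * ‖A‖ + 3 * C) * ‖U a N‖ := by
    intro a N n
    have hn : min n N ≤ N := min_le_right _ _
    set n' := min n N with hn'
    have hsplit : ∀ f : ℕ → X, ∑ j ∈ Finset.range N, f j =
        ∑ j ∈ Finset.range n', f j + ∑ j ∈ Finset.Ico n' N, f j := fun f =>
      (Finset.sum_range_add_sum_Ico f hn).symm
    have h1 : B n (U a N) = (∑ j ∈ Finset.range n', a j • (B n (e j) - A (e j)) + A (U a n')) +
        (∑ j ∈ Finset.Ico n' N, a j • (B n (e j) - L n (x j)) + L n (P a N - P a n')) := by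
      have h2 : P a N - P a n' = ∑ j ∈ Finset.Ico n' N, a j • x j := by
        simp only [P, hsplit, add_sub_cancel_left]
      rw [h2]
      simp only [U, map_sum, map_smul, smul_sub, Finset.sum_sub_distrib, sub_add_cancel]
      exact hsplit _
    have h2 : ‖∑ j ∈ Finset.range n', a j • (B n (e j) - A (e j))‖ ≤ ‖P a N‖ / 2 :=
      herr a N _ _ (Finset.range_subset_range.2 hn) fun j hj => hBA j n
        ((Finset.mem_range.1 hj).trans_le (min_le_left _ _))
    have h3 : ‖∑ j ∈ Finset.Ico n' N, a j • (B n (e j) - L n (x j))‖ ≤ ‖P a N‖ / 2 := by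
      refine herr a N _ _ (fun j hj => Finset.mem_range.2 (Finset.mem_Ico.1 hj).2) fun j hj => ?_
      have := Finset.mem_Ico.1 hj
      exact hBL j n (by omega)
    have h4 : ‖A (U a n')‖ ≤ ‖A‖ * (3 * ‖P a N‖) := by
      refine A.le_opNorm_of_le ?_
      have h5 : ‖U a n'‖ ≤ ‖P a n'‖ + ‖U a n' - P a n'‖ := by
        have := norm_add_le (P a n') (U a n' - P a n')
        rwa [add_sub_cancel] at this
      have h6 : ‖P a n'‖ ≤ 2 * ‖P a N‖ := hproj a n' N hn
      linarith [hUP a n' N hn, norm_nonneg (P a N)]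
    have h5 : ‖L n (P a N - P a n')‖ ≤ C * (3 * ‖P a N‖) := by
      refine ((L n).le_of_opNorm_le (hL n) _).trans (mul_le_mul_of_nonneg_left ?_ hC)
      have h6 : ‖P a n'‖ ≤ 2 * ‖P a N‖ := hproj a n' N hn
      linarith [norm_sub_le (P a N) (P a n')]
    calc _ ≤ (‖P a N‖ / 2 + ‖A‖ * (3 * ‖P a N‖)) + (‖P a N‖ / 2 + C * (3 * ‖P a N‖)) := by
          rw [h1]
          exact (norm_add_le _ _).trans (add_le_add ((norm_add_le _ _).trans (add_le_add h2 h4))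
            ((norm_add_le _ _).trans (add_le_add h3 h5)))
      _ = (1 + 3 * ‖A‖ + 3 * C) * ‖P a N‖ := by ring
      _ ≤ (1 + 3 * ‖A‖ + 3 * C) * (2 * ‖U a N‖) :=
          mul_le_mul_of_nonneg_left (hPU a N) (by positivity)
      _ = _ := by ring
  have hspan : ∀ u ∈ Submodule.span ℝ (Set.range e), ∃ a N, u = U a N := by
    intro u hu
    obtain ⟨c, rfl⟩ := Finsupp.mem_span_range_iff_exists_finsupp.1 hu
    obtain ⟨N, hN⟩ := Finset.exists_nat_subset_range c.support
    exact ⟨c, N, Finsupp.sum_of_support_subset c hN _ (by simp)⟩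
  have hli : LinearIndependent ℝ e := by
    rw [linearIndependent_iff'']
    intro s g hg hsum i
    obtain ⟨N, hN⟩ := Finset.exists_nat_subset_range (insert i s)
    have hU : U g N = 0 := by
      rw [← hsum]
      refine (Finset.sum_subset ((Finset.subset_insert i s).trans hN) fun j _ hj => ?_).symm
      rw [hg j hj, zero_smul]
    have h1 := hPU g N
    rw [hU, norm_zero, mul_zero] at h1
    have h2 := hcoef g N i (Finset.mem_range.1 (hN (Finset.mem_insert_self i s)))
    exact abs_nonpos_iff.1 (by linarith)
  refine ⟨(Submodule.span ℝ (Set.range e)).topologicalClosure,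
    ⟨Submodule.isClosed_topologicalClosure _, fun hfin => ?_⟩, fun y hy => ?_⟩
  · let e' : ℕ → (Submodule.span ℝ (Set.range e)).topologicalClosure := fun j =>
      ⟨e j, Submodule.le_topologicalClosure _ (Submodule.subset_span ⟨j, rfl⟩)⟩
    have hli' : LinearIndependent ℝ e' := LinearIndependent.of_comp (Submodule.subtype _) hli
    exact not_finite_iff_infinite.2 (inferInstance : Infinite ℕ)
      hli'.finite_of_isNoetherian
  · refine tendsto_of_mem_topologicalClosure (M := 2 * (1 + 3 * ‖A‖ + 3 * C)) (fun n u hu => ?_)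
      (fun u hu => ?_) hy
    · obtain ⟨a, N, rfl⟩ := hspan u hu
      exact hB a N n
    · obtain ⟨a, N, rfl⟩ := hspan u hu
      simp only [U, map_sum, map_smul]
      exact tendsto_finsetSum _ fun j _ => (hlim j).const_smul (a j)

end BasicSequence

/-! ### Inductive construction of the basic sequence and of the subsequence of powers. -/

section Construction

variable {X : Type*} [NormedAddCommGroup X] [NormedSpace ℝ X]

/-- The data chosen at one stage of the construction of a perturbed basic sequence. -/
structure Stage (X : Type*) [NormedAddCommGroup X] [NormedSpace ℝ X] where
  x : X
  e : X
  p : ℕ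
  W : Set X
  s : Set (StrongDual ℝ X)
  ε : ℝ

/-- If the powers of `T` are approximated by bounded operators on vectors in every subspace of finite
codimension, and `T ^ k n` converges to `A` on a dense set, then a subsequence of `T ^ k n` converges
to `A` on an infinite-dimensional closed subspace. -/
theorem exists_isInfDimClosed_tendsto {T A : X →L[ℝ] X} {C : ℝ} {L : ℕ → X →L[ℝ] X}
    (hL : ∀ m, ‖L m‖ ≤ C)
    (happrox : ∀ s : Set (StrongDual ℝ X), s.Finite → ∀ (n : ℕ), ∀ ε > 0,
        ∃ x, ‖x‖ = 1 ∧ (∀ f ∈ s, f x = 0) ∧ ∀ m ≤ n, ‖(T ^ m) x - L m x‖ ≤ ε)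
    {Y : Set X} (hY : Dense Y) {k : ℕ → ℕ} (hk : StrictMono k)
    (hkY : ∀ y ∈ Y, Tendsto (fun n => (T ^ k n) y) atTop (𝓝 (A y))) :
    ∃ E : Submodule ℝ X, IsInfDimClosed E ∧ ∃ p : ℕ → ℕ, StrictMono p ∧
      ∀ y ∈ E, Tendsto (fun n => (T ^ k (p n)) y) atTop (𝓝 (A y)) := by
  -- Here W gathers the basic vectors so far, s is the Mazur set of functionals for their span, and
  -- e is the perturbation of x into Y.
  let P : Stage X → Prop := fun b => (0 < b.ε ∧ b.ε ≤ 1 / 16) ∧ (b.W.Finite ∧ b.x ∈ b.W) ∧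
    (b.s.Finite ∧ ∀ u ∈ Submodule.span ℝ b.W, ∀ v, (∀ f ∈ b.s, f v = 0) → ‖u‖ ≤ 2 * ‖u + v‖) ∧
    ‖b.x‖ = 1 ∧ b.e ∈ Y ∧ ‖b.e - b.x‖ ≤ b.ε ∧ ‖(T ^ k b.p) b.e - L (k b.p) b.x‖ ≤ b.ε
  let r : Stage X → Stage X → Prop := fun a b => a.W ⊆ b.W ∧ (∀ f ∈ a.s, f b.x = 0) ∧
    (a.p < b.p ∧ ‖(T ^ k b.p) a.e - A a.e‖ ≤ a.ε) ∧ b.ε ≤ a.ε / 2 ∧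
    ‖(T ^ k a.p) b.e - L (k a.p) b.x‖ ≤ b.ε
  have hstep : ∀ S : Finset (Stage X), (∀ a ∈ S, P a) → ∃ b, P b ∧ ∀ a ∈ S, r a b := by
    intro S hS
    obtain ⟨ε, ⟨hε1, hεS⟩, hε0 : 0 < ε⟩ : ∃ ε : ℝ, (ε ≤ 1 / 16 ∧ ∀ a ∈ S, ε ≤ a.ε / 2) ∧ 0 < ε := by
      have h1 : ∀ c : ℝ, 0 < c → ∀ᶠ ε in 𝓝[>] (0 : ℝ), ε ≤ c := fun c hc =>
        (eventually_le_nhds hc).filter_mono nhdsWithin_le_nhds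
      exact (((h1 _ (by norm_num)).and ((Finset.eventually_all S).2 fun a ha =>
        h1 _ (half_pos (hS a ha).1.1))).and self_mem_nhdsWithin).exists
    -- The index comes before the vector: p must be late for all earlier perturbations, whereas the
    -- new x must be good for every exponent up to k p.
    obtain ⟨p, hp⟩ : ∃ p, ∀ a ∈ S, a.p < p ∧ ‖(T ^ k p) a.e - A a.e‖ ≤ a.ε := by
      refine ((Finset.eventually_all S).2 fun a ha => ?_).exists (f := atTop)
      obtain ⟨⟨ha0, -⟩, -, -, -, haY, -⟩ := hS a ha
      have h1 := tendsto_iff_norm_sub_tendsto_zero.1 (hkY a.e haY)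
      exact (eventually_gt_atTop a.p).and (h1.eventually_le_const ha0)
    obtain ⟨x, hx1, hxs, hxT⟩ := happrox (⋃ a ∈ S, a.s)
      (S.finite_toSet.biUnion fun a ha => (hS a ha).2.2.1.1) (k p) (ε / 2) (half_pos hε0)
    obtain ⟨e, ⟨hex, heT⟩, heY⟩ : ∃ e, (‖e - x‖ ≤ ε ∧
        ∀ m ∈ Finset.range (k p + 1), ‖(T ^ m) e - (T ^ m) x‖ ≤ ε / 2) ∧ e ∈ Y := by
      have h1 : ∀ (R : X →L[ℝ] X) (δ : ℝ), 0 < δ → ∀ᶠ e in 𝓝 x, ‖R e - R x‖ ≤ δ := by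
        intro R δ hδ
        exact (tendsto_iff_norm_sub_tendsto_zero.1 (R.continuous.tendsto x)).eventually_le_const hδ
      exact (((h1 (ContinuousLinearMap.id ℝ X) ε hε0).and ((Finset.eventually_all _).2 fun m _ =>
        h1 (T ^ m) _ (half_pos hε0))).and_frequently (mem_closure_iff_frequently.1 (hY x))).exists
    have heL : ∀ m ≤ k p, ‖(T ^ m) e - L m x‖ ≤ ε := by
      intro m hm
      have h1 := heT m (Finset.mem_range.2 (Nat.lt_succ_of_le hm))
      have h2 := hxT m hm
      have h3 := norm_add_le ((T ^ m) e - (T ^ m) x) ((T ^ m) x - L m x)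
      rw [sub_add_sub_cancel] at h3
      linarith
    have hW : (insert x (⋃ a ∈ S, a.W)).Finite :=
      (S.finite_toSet.biUnion fun a ha => (hS a ha).2.1.1).insert x
    have := FiniteDimensional.span_of_finite ℝ hW
    obtain ⟨s, hs, hsW⟩ := exists_finite_norm_le_add
      (Submodule.span ℝ (insert x (⋃ a ∈ S, a.W)))
    refine ⟨⟨x, e, p, insert x (⋃ a ∈ S, a.W), s, ε⟩,
      ⟨⟨hε0, hε1⟩, ⟨hW, Set.mem_insert _ _⟩, ⟨hs, hsW⟩, hx1, heY, hex, heL _ le_rfl⟩,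
      fun a ha => ⟨fun w hw => Set.mem_insert_of_mem _ (Set.mem_biUnion ha hw),
        fun f hf => hxs f (Set.mem_biUnion ha hf), hp a ha, hεS a ha,
        heL _ (hk.monotone (hp a ha).1.le)⟩⟩
  obtain ⟨b, hP, hr⟩ := exists_seq_of_forall_finset_exists P r hstep
  have hεpow : ∀ j, (b j).ε ≤ 1 / 16 * (1 / 2) ^ j := by
    intro j
    induction j with
    | zero => simpa using (hP 0).1.2
    | succ j ih =>
      have := (hr j (j + 1) (Nat.lt_succ_self j)).2.2.2.1
      rw [pow_succ]
      linarith
  have hWmono : ∀ i j, i ≤ j → (b i).W ⊆ (b j).W := by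
    intro i j hij
    rcases hij.eq_or_lt with rfl | hij
    · exact subset_rfl
    · exact (hr i j hij).1
  have hp : StrictMono fun n => (b n).p :=
    strictMono_nat_of_lt_succ fun n => (hr n (n + 1) (Nat.lt_succ_self n)).2.2.1.1
  have hproj : ∀ (a : ℕ → ℝ) (n N : ℕ), n ≤ N → ‖∑ j ∈ Finset.range n, a j • (b j).x‖ ≤
      2 * ‖∑ j ∈ Finset.range N, a j • (b j).x‖ := by
    intro a n N hn
    rcases n with - | i
    · simp
    · rw [← Finset.sum_range_add_sum_Ico _ hn]
      refine (hP i).2.2.1.2 _ (Submodule.sum_mem _ fun j hj => Submodule.smul_mem _ _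
        (Submodule.subset_span (hWmono j i (Nat.lt_succ_iff.1 (Finset.mem_range.1 hj))
          (hP j).2.1.2))) _ fun f hf => ?_
      rw [map_sum]
      refine Finset.sum_eq_zero fun j hj => ?_
      rw [map_smul, (hr i j (Finset.mem_Ico.1 hj).1).2.1 f hf, smul_zero]
  have hεsum : ∀ N, ∑ j ∈ Finset.range N, (b j).ε ≤ 1 / 8 := fun N => by
    calc ∑ j ∈ Finset.range N, (b j).ε ≤ ∑ j ∈ Finset.range N, 1 / 16 * (1 / 2 : ℝ) ^ j :=
          Finset.sum_le_sum fun j _ => hεpow j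
      _ = 1 / 16 * ∑ j ∈ Finset.range N, (1 / 2 : ℝ) ^ j := by rw [Finset.mul_sum]
      _ ≤ 1 / 16 * 2 := mul_le_mul_of_nonneg_left (sum_geometric_two_le N) (by norm_num)
      _ = 1 / 8 := by norm_num
  have hBL : ∀ j n, n ≤ j → ‖(T ^ k (b n).p) (b j).e - L (k (b n).p) (b j).x‖ ≤ (b j).ε := by
    intro j n hnj
    rcases hnj.eq_or_lt with rfl | hnj
    · exact (hP n).2.2.2.2.2.2
    · exact (hr n j hnj).2.2.2.2
  obtain ⟨E, hE, hElim⟩ := exists_isInfDimClosed_of_basicSequence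
    (B := fun n => T ^ k (b n).p) (L := fun n => L (k (b n).p))
    (fun j => (hP j).2.2.2.1) hproj (fun j => (hP j).1.1.le) hεsum
    (fun j => (hP j).2.2.2.2.2.1) (fun n => hL _) (fun j n hjn => (hr j n hjn).2.2.1.2) hBL
    (fun j => (hkY _ (hP j).2.2.2.2.1).comp hp.tendsto_atTop)
  exact ⟨E, hE, fun n => (b n).p, hp, hElim⟩

end Construction

/-! ### The hypercyclicity criterion and the passage to a hypercyclic subspace. -/

section HypercyclicSubspace

variable {X : Type*} [NormedAddCommGroup X] [NormedSpace ℝ X]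

lemma frequently_mem_of_denseRange {E : Type*} [TopologicalSpace E] [T1Space E]
    [∀ x : E, (𝓝[≠] x).NeBot] {u : ℕ → E} (hu : DenseRange u) {O : Set E} (hO : IsOpen O)
    (hne : O.Nonempty) : ∃ᶠ n in atTop, u n ∈ O := by
  refine frequently_atTop.2 fun N => ?_
  obtain ⟨y, hyO, ⟨n, rfl⟩, hn⟩ :=
    (hu.sdiff_finite ((Set.finite_Iio N).image u)).inter_open_nonempty O hO hne
  exact ⟨n, not_lt.1 fun h => hn ⟨n, h, rfl⟩, hyO⟩

lemma directSumPower_pow_apply (T : X →L[ℝ] X) (N n : ℕ) (v : Fin N → X) (i : Fin N) :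
    (directSumPower T N ^ n) v i = (T ^ n) (v i) := by
  induction n with
  | zero => rfl
  | succ n ih =>
    rw [pow_succ', pow_succ', mul_apply_eq_comp, mul_apply_eq_comp, ← ih]
    rfl

/-- Weakly mixing operators satisfy the hypercyclicity criterion. -/
theorem IsWeaklyMixing.exists_criterion [Nontrivial X] {T : X →L[ℝ] X} (hT : IsWeaklyMixing T) :
    ∃ (k : ℕ → ℕ) (w : ℕ → X), StrictMono k ∧ DenseRange w ∧
      (∀ j, Tendsto (fun n => (T ^ k n) (w j)) atTop (𝓝 0)) ∧
      ∀ j, ∃ v : ℕ → X, Tendsto v atTop (𝓝 0) ∧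
        Tendsto (fun n => (T ^ k n) (v n)) atTop (𝓝 (w j)) := by
  obtain ⟨v, hv⟩ := hT 2 (by norm_num)
  have hv' : DenseRange fun n : ℕ => (directSumPower T 2 ^ n) v := hv
  have hneBot : ∀ x : Fin 2 → X, (𝓝[≠] x).NeBot := fun x => Module.punctured_nhds_neBot ℝ _ x
  set x := v 0
  set y := v 1
  -- At these times x is sent near 0 and y near (j+1)x, so y/(j+1) is a small vector sent near x.
  -- The dense sequence will be the orbit of x, to which both facts transfer because powers commute.
  have hfreq : ∀ j : ℕ, ∃ᶠ n in atTop, ‖(T ^ n) x‖ < 1 / ((j : ℝ) + 1) ∧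
      ‖(T ^ n) y - ((j : ℝ) + 1) • x‖ < 1 := by
    intro j
    have hO : IsOpen {u : Fin 2 → X | ‖u 0‖ < 1 / ((j : ℝ) + 1) ∧ ‖u 1 - ((j : ℝ) + 1) • x‖ < 1} :=
      IsOpen.and (isOpen_lt (by fun_prop) (by fun_prop)) (isOpen_lt (by fun_prop) (by fun_prop))
    refine (frequently_mem_of_denseRange hv' hO ⟨![0, ((j : ℝ) + 1) • x], ?_⟩).mono fun n hn => ?_
    · simp only [Set.mem_ofPred_eq, Matrix.cons_val_zero, norm_zero, Matrix.cons_val_one, sub_self,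
        zero_lt_one, and_true]
      positivity
    · simpa only [Set.mem_ofPred_eq, directSumPower_pow_apply] using hn
  obtain ⟨k, hk, hkxy⟩ := extraction_forall_of_frequently hfreq
  have hxlim : Tendsto (fun n => (T ^ k n) x) atTop (𝓝 0) :=
    squeeze_zero_norm (fun n => (hkxy n).1.le) tendsto_one_div_add_atTop_nhds_zero_nat
  have hylim : Tendsto (fun n : ℕ => (T ^ k n) (((n : ℝ) + 1)⁻¹ • y)) atTop (𝓝 x) := by
    rw [tendsto_iff_norm_sub_tendsto_zero]
    refine squeeze_zero (fun n => norm_nonneg _) (fun n => ?_)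
      tendsto_one_div_add_atTop_nhds_zero_nat
    have hn : (0 : ℝ) < n + 1 := by positivity
    have h1 : (T ^ k n) (((n : ℝ) + 1)⁻¹ • y) - x =
        ((n : ℝ) + 1)⁻¹ • ((T ^ k n) y - ((n : ℝ) + 1) • x) := by
      rw [map_smul, smul_sub, smul_smul, inv_mul_cancel₀ hn.ne', one_smul]
    rw [h1, norm_smul, norm_inv, Real.norm_of_nonneg hn.le, one_div]
    exact mul_le_of_le_one_right (by positivity) (hkxy n).2.le
  have hcomm : ∀ n m z, (T ^ n) ((T ^ m) z) = (T ^ m) ((T ^ n) z) := fun n m z => by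
    rw [← mul_apply_eq_comp, ← mul_apply_eq_comp, ← pow_add, ← pow_add, add_comm]
  refine ⟨k, fun m => (T ^ m) x, hk, ?_, fun m => ?_, fun m =>
    ⟨fun n => (T ^ m) (((n : ℝ) + 1)⁻¹ • y), ?_, ?_⟩⟩
  · have h1 : DenseRange fun u : Fin 2 → X => u 0 :=
      Function.Surjective.denseRange fun z => ⟨fun _ => z, rfl⟩
    have h2 := h1.comp hv' (continuous_apply 0)
    refine h2.mono ?_
    rintro _ ⟨n, rfl⟩
    exact ⟨n, (directSumPower_pow_apply T 2 n v 0).symm⟩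
  · simp only [hcomm _ m]
    have h1 := ((T ^ m).continuous.tendsto 0).comp hxlim
    rwa [map_zero] at h1
  · have h1 : Tendsto (fun n : ℕ => ((n : ℝ) + 1)⁻¹ • y) atTop (𝓝 0) := by
      simpa [one_div] using (tendsto_one_div_add_atTop_nhds_zero_nat (𝕜 := ℝ)).smul_const y
    have h2 := ((T ^ m).continuous.tendsto 0).comp h1
    rwa [map_zero] at h2
  · simp only [hcomm _ m]
    exact ((T ^ m).continuous.tendsto x).comp hylim

/-- Take norming functionals at a dense sequence: one taken at a point close to x cannot vanish at
x. -/
lemma exists_separating_seq_strongDual [TopologicalSpace.SeparableSpace X] :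
    ∃ φ : ℕ → StrongDual ℝ X, ∀ x, x ≠ 0 → ∃ i, φ i x ≠ 0 := by
  choose g hg1 hg2 using fun y : X => exists_dual_vector'' ℝ y
  refine ⟨fun i => g (TopologicalSpace.denseSeq X i), fun x hx => ?_⟩
  obtain ⟨i, hi⟩ := (TopologicalSpace.denseRange_denseSeq X).exists_dist_lt x
    (half_pos (norm_pos_iff.2 hx))
  refine ⟨i, fun h0 => ?_⟩
  set y := TopologicalSpace.denseSeq X i
  rw [dist_eq_norm] at hi
  have h1 : g y (y - x) = ‖y‖ := by
    change g y x = 0 at h0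
    rw [map_sub, h0, sub_zero]
    simpa using hg2 y
  have h2 : ‖g y (y - x)‖ ≤ ‖y - x‖ := by simpa using (g y).le_of_opNorm_le (hg1 y) (y - x)
  rw [h1, norm_norm, norm_sub_rev] at h2
  have h3 : ‖x‖ ≤ ‖y‖ + ‖x - y‖ := by simpa using norm_add_le y (x - y)
  linarith

variable [CompleteSpace X]

/-- Under the hypercyclicity criterion along `l` there is an operator `K` of norm less than one such
that `T ^ l n * K` approximates the given rank one operators. -/
lemma exists_norm_lt_one_approx {T : X →L[ℝ] X} {l : ℕ → ℕ} {w : ℕ → X} (hw : DenseRange w)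
    (hw0 : ∀ j, Tendsto (fun n => (T ^ l n) (w j)) atTop (𝓝 0))
    (hwv : ∀ j, ∃ v : ℕ → X, Tendsto v atTop (𝓝 0) ∧
      Tendsto (fun n => (T ^ l n) (v n)) atTop (𝓝 (w j))) (φ : ℕ → StrongDual ℝ X) :
    ∃ K : X →L[ℝ] X, ‖K‖ < 1 ∧ ∀ i j m : ℕ, ∃ n ≥ m,
      ‖T ^ l n * K - (φ i).smulRight (w j)‖ < 1 / ((m : ℝ) + 1) := by
  have hsmul : ∀ (f : StrongDual ℝ X) n v, T ^ n * f.smulRight v = f.smulRight ((T ^ n) v) := by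
    intro f n v
    ext x
    simp only [mul_apply_eq_comp, ContinuousLinearMap.smulRight_apply, map_smul]
  have hcont : ∀ f : StrongDual ℝ X, Continuous fun v : X => f.smulRight v := fun f =>
    (ContinuousLinearMap.smulRightL ℝ X X f).continuous
  -- The Baire argument takes place in the closure of D, which contains all rank one operators,
  -- while D itself is the dense set to be perturbed.
  let D : Submodule ℝ (X →L[ℝ] X) :=
    { carrier := {K | Tendsto (fun n => T ^ l n * K) atTop (𝓝 0)}
      zero_mem' := by simp
      add_mem' := fun {K K'} (hK : Tendsto _ _ _) (hK' : Tendsto _ _ _) => by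
        have h := hK.add hK'
        simp only [← mul_add, add_zero] at h
        exact h
      smul_mem' := fun c K (hK : Tendsto _ _ _) => by
        have h := hK.const_smul c
        simp only [← mul_smul_comm, smul_zero] at h
        exact h }
  have hDw : ∀ (f : StrongDual ℝ X) j, f.smulRight (w j) ∈ D := by
    intro f j
    change Tendsto _ _ _
    simp only [hsmul]
    have h := ((hcont f).tendsto 0).comp (hw0 j)
    rwa [show f.smulRight (0 : X) = 0 by ext; simp] at h
  have hF : ∀ (f : StrongDual ℝ X) v, f.smulRight v ∈ D.topologicalClosure := by
    intro f v
    have h1 := (hcont f).range_subset_closure_image_dense hw ⟨v, rfl⟩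
    refine closure_mono ?_ h1
    rintro _ ⟨_, ⟨j, rfl⟩, rfl⟩
    exact hDw f j
  have : CompleteSpace D.topologicalClosure := D.isClosed_topologicalClosure.completeSpace_coe
  let O : ℕ × ℕ × ℕ → Set D.topologicalClosure := fun q => {K | ∃ n ≥ q.2.2,
    ‖T ^ l n * (K : X →L[ℝ] X) - (φ q.1).smulRight (w q.2.1)‖ < 1 / ((q.2.2 : ℝ) + 1)}
  have hOopen : ∀ q, IsOpen (O q) := by
    intro q
    have : O q = ⋃ n ∈ Set.Ici q.2.2, {K : D.topologicalClosure |
        ‖T ^ l n * (K : X →L[ℝ] X) - (φ q.1).smulRight (w q.2.1)‖ < 1 / ((q.2.2 : ℝ) + 1)} := by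
      ext K; simp [O]
    rw [this]
    exact isOpen_biUnion fun n _ => isOpen_lt (by fun_prop) (by fun_prop)
  have hDdense : Dense {K : D.topologicalClosure | (K : X →L[ℝ] X) ∈ D} := by
    rw [Subtype.dense_iff]
    intro K hK
    refine closure_mono ?_ hK
    exact fun K hK => ⟨⟨K, D.le_topologicalClosure hK⟩, hK, rfl⟩
  have hOdense : ∀ q, Dense (O q) := by
    rintro ⟨i, j, m⟩
    rw [← dense_closure]
    refine hDdense.mono fun K hK => ?_
    obtain ⟨v, hv0, hv⟩ := hwv j
    -- The rank one perturbation tends to zero, yet `T ^ l n` carries it to the prescribed rank one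
    -- operator in the limit.
    let R : ℕ → D.topologicalClosure := fun n => K + ⟨(φ i).smulRight (v n), hF _ _⟩
    have hR : Tendsto R atTop (𝓝 K) := by
      rw [tendsto_subtype_rng]
      have h1 := ((hcont (φ i)).tendsto 0).comp hv0
      simpa [R, Function.comp_def] using h1.const_add (K : X →L[ℝ] X)
    refine mem_closure_of_tendsto hR ?_
    have hlim : Tendsto (fun n => T ^ l n * (R n : X →L[ℝ] X) - (φ i).smulRight (w j))
        atTop (𝓝 0) := by
      have h1 : ∀ n, T ^ l n * (R n : X →L[ℝ] X) - (φ i).smulRight (w j) =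
          T ^ l n * (K : X →L[ℝ] X) +
            ((φ i).smulRight ((T ^ l n) (v n)) - (φ i).smulRight (w j)) := by
        intro n
        rw [← hsmul, ← add_sub_assoc, ← mul_add]
        rfl
      simp only [h1]
      have h2 := (((hcont (φ i)).tendsto (w j)).comp hv).sub_const ((φ i).smulRight (w j))
      have hK' : Tendsto (fun n => T ^ l n * (K : X →L[ℝ] X)) atTop (𝓝 0) := hK
      simpa [Function.comp_def] using hK'.add h2
    have hm : (0 : ℝ) < 1 / ((m : ℝ) + 1) := by positivity
    filter_upwards [eventually_ge_atTop m, (tendsto_zero_iff_norm_tendsto_zero.1 hlim).eventually_lt_const hm]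
      with n hn hn'
    exact ⟨n, hn, hn'⟩
  obtain ⟨K, hK1, hK⟩ := (dense_iInter_of_isOpen hOopen hOdense).exists_mem_open
    Metric.isOpen_ball ⟨0, Metric.mem_ball_self one_pos⟩
  refine ⟨K, by simpa using hK, fun i j m => ?_⟩
  exact Set.mem_iInter.1 hK1 (i, j, m)

/-- An operator satisfying the hypercyclicity criterion along `l` whose powers `T ^ l n` converge to
zero on an infinite-dimensional closed subspace has a hypercyclic subspace. -/
theorem hasHypercyclicSubspace_of_criterion [TopologicalSpace.SeparableSpace X] {T : X →L[ℝ] X}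
    {l : ℕ → ℕ} {w : ℕ → X} (hw : DenseRange w)
    (hw0 : ∀ j, Tendsto (fun n => (T ^ l n) (w j)) atTop (𝓝 0))
    (hwv : ∀ j, ∃ v : ℕ → X, Tendsto v atTop (𝓝 0) ∧
      Tendsto (fun n => (T ^ l n) (v n)) atTop (𝓝 (w j)))
    {E : Submodule ℝ X} (hE : IsInfDimClosed E)
    (hE0 : ∀ x ∈ E, Tendsto (fun n => (T ^ l n) x) atTop (𝓝 0)) :
    HasHypercyclicSubspace T := by
  obtain ⟨φ, hφ⟩ := exists_separating_seq_strongDual (X := X)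
  obtain ⟨K, hK1, hK⟩ := exists_norm_lt_one_approx hw hw0 hwv φ
  -- Since K has norm below one, R is bounded below. On R x the part x dies along l, while K x is
  -- steered near multiples of the dense vectors.
  let R : X →L[ℝ] X := 1 + K
  have hR : ∀ x, (1 - ‖K‖) * ‖x‖ ≤ ‖R x‖ := by
    intro x
    have h1 : ‖x‖ ≤ ‖R x‖ + ‖K x‖ := by
      have := norm_sub_le (R x) (K x)
      simpa [R] using this
    linarith [K.le_opNorm x]
  have hinj : Function.Injective R := by
    refine (injective_iff_map_eq_zero R).2 fun x hx => ?_
    have h1 := hR x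
    rw [hx, norm_zero] at h1
    exact norm_le_zero_iff.1 (nonpos_of_mul_nonpos_right h1 (sub_pos.2 hK1))
  refine ⟨E.map R.toLinearMap, ⟨isClosed_map_of_norm_le hE.1 (sub_pos.2 hK1) fun x _ => hR x,
    fun hfin => hE.2 ?_⟩, ?_⟩
  · exact (E.equivMapOfInjective R.toLinearMap hinj).symm.finiteDimensional
  rintro _ ⟨x, hx, rfl⟩ hx0
  have hx0' : x ≠ 0 := by
    rintro rfl
    exact hx0 (map_zero _)
  obtain ⟨i, hi⟩ := hφ x hx0'
  refine Metric.dense_iff.2 fun u ε hε => ?_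
  have hsurj : DenseRange fun v : X => φ i x • v :=
    Function.Surjective.denseRange fun v => ⟨(φ i x)⁻¹ • v, by simp [smul_smul, hi]⟩
  obtain ⟨j, hj⟩ := (hsurj.comp hw (by fun_prop)).exists_dist_lt u (show 0 < ε / 3 by positivity)
  have h1 : Tendsto (fun m : ℕ => 1 / ((m : ℝ) + 1) * ‖x‖) atTop (𝓝 0) := by
    simpa using (tendsto_one_div_add_atTop_nhds_zero_nat (𝕜 := ℝ)).mul_const ‖x‖
  have h2 : Tendsto (fun n => ‖(T ^ l n) x‖) atTop (𝓝 0) := by simpa using (hE0 x hx).norm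
  obtain ⟨m, hm1, hm2⟩ := ((h1.eventually_lt_const (show 0 < ε / 3 by positivity)).and
    (eventually_forall_ge_atTop.2 (h2.eventually_lt_const (show 0 < ε / 3 by positivity)))).exists
  obtain ⟨n, hnm, hn⟩ := hK i j m
  refine ⟨(T ^ l n) (R x), ?_, ⟨l n, rfl⟩⟩
  have h3 : ‖(T ^ l n) (K x) - φ i x • w j‖ ≤ 1 / ((m : ℝ) + 1) * ‖x‖ :=
    (T ^ l n * K - (φ i).smulRight (w j)).le_of_opNorm_le hn.le x
  have h4 : (T ^ l n) (R x) - u = (T ^ l n) x + ((T ^ l n) (K x) - φ i x • w j) -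
      (u - φ i x • w j) := by
    have : R x = x + K x := rfl
    rw [this, map_add]
    abel
  rw [Metric.mem_ball, dist_eq_norm, h4]
  have h5 := hm2 n hnm
  have h6 : ‖u - φ i x • w j‖ < ε / 3 := by rw [← dist_eq_norm]; exact hj
  refine (norm_sub_le _ _).trans_lt ?_
  linarith [norm_add_le ((T ^ l n) x) ((T ^ l n) (K x) - φ i x • w j)]

end HypercyclicSubspace

/-! ### Absence of eigenfunctionals, obstructions to escaping orbits, and assembly. -/

section Equivalences

variable {X : Type*} [NormedAddCommGroup X] [NormedSpace ℝ X]

lemma apply_pow_of_eigenfunctional {T : X →L[ℝ] X} {c : ℂ} {g : X →L[ℝ] ℂ}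
    (hg : ∀ x, g (T x) = c * g x) (n : ℕ) (x : X) : g ((T ^ n) x) = c ^ n * g x := by
  induction n with
  | zero => simp
  | succ n ih => rw [pow_succ', mul_apply_eq_comp, hg, ih, pow_succ', mul_assoc]

lemma IsWeaklyMixing.isHypercyclic {T : X →L[ℝ] X} (hT : IsWeaklyMixing T) :
    IsHypercyclic T := by
  obtain ⟨v, hv⟩ := hT 1 le_rfl
  have hv' : DenseRange fun n : ℕ => (directSumPower T 1 ^ n) v := hv
  have h1 : DenseRange fun u : Fin 1 → X => u 0 :=
    Function.Surjective.denseRange fun z => ⟨fun _ => z, rfl⟩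
  refine ⟨v 0, (h1.comp hv' (continuous_apply 0)).mono ?_⟩
  rintro _ ⟨n, rfl⟩
  exact ⟨n, (directSumPower_pow_apply T 1 n v 0).symm⟩

/-- Along a dense orbit |g| never exceeds its initial value, so g is a bounded function on X, and a
bounded linear map vanishes. -/
lemma IsHypercyclic.eigenfunctional_eq_zero {T : X →L[ℝ] X} (hT : IsHypercyclic T) {c : ℂ}
    (hc : ‖c‖ < 1) {g : X →L[ℝ] ℂ} (hg : ∀ x, g (T x) = c * g x) : g = 0 := by
  obtain ⟨x, hx⟩ := hT
  have hle : ∀ y, ‖g y‖ ≤ ‖g x‖ := by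
    have hcl : IsClosed {y | ‖g y‖ ≤ ‖g x‖} := isClosed_le (by fun_prop) (by fun_prop)
    intro y
    refine closure_minimal ?_ hcl (hx y)
    rintro _ ⟨n, rfl⟩
    change ‖g ((T ^ n) x)‖ ≤ ‖g x‖
    rw [apply_pow_of_eigenfunctional hg, norm_mul, norm_pow]
    exact mul_le_of_le_one_left (norm_nonneg _) (pow_le_one₀ (norm_nonneg _) hc.le)
  ext y
  by_contra hy
  have hy' : 0 < ‖g y‖ := norm_pos_iff.2 hy
  have h1 := hle (((‖g x‖ + 1) / ‖g y‖) • y)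
  rw [map_smul, norm_smul, Real.norm_of_nonneg (by positivity), div_mul_cancel₀ _ hy'.ne'] at h1
  linarith

/-- On Y the value g(y) is the limit of c^(k n) g(y), which is zero. -/
lemma IsQuasiRigid.eigenfunctional_eq_zero {T : X →L[ℝ] X} (hT : IsQuasiRigid T) {c : ℂ}
    (hc : ‖c‖ < 1) {g : X →L[ℝ] ℂ} (hg : ∀ x, g (T x) = c * g x) : g = 0 := by
  obtain ⟨k, hk, Y, hY, hkY⟩ := hT
  have hYg : ∀ y ∈ Y, g y = 0 := by
    intro y hy
    have h1 := (g.continuous.tendsto y).comp (hkY y hy)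
    have h2 : Tendsto (fun n => c ^ k n * g y) atTop (𝓝 0) := by
      simpa using ((tendsto_pow_atTop_nhds_zero_of_norm_lt_one hc).comp hk.tendsto_atTop).mul_const
        (g y)
    refine tendsto_nhds_unique h1 (h2.congr fun n => ?_)
    exact (apply_pow_of_eigenfunctional hg (k n) y).symm
  exact DFunLike.coe_injective (Continuous.ext_on hY g.continuous continuous_zero hYg)

lemma bddAbove_range_norm_comp_subtypeL [CompleteSpace X] {E : Submodule ℝ X}
    (hE : IsClosed (E : Set X)) {B : ℕ → X →L[ℝ] X} {A : X → X}
    (h : ∀ x ∈ E, Tendsto (fun n => B n x) atTop (𝓝 (A x))) :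
    BddAbove (Set.range fun n => ‖(B n).comp E.subtypeL‖) := by
  have : CompleteSpace E := hE.completeSpace_coe
  obtain ⟨C, hC⟩ := banach_steinhaus (g := fun n => (B n).comp E.subtypeL) fun x => by
    obtain ⟨C, hC⟩ := (h x x.2).norm.bddAbove_range
    exact ⟨C, fun n => hC ⟨n, rfl⟩⟩
  exact ⟨C, by rintro _ ⟨n, rfl⟩; exact hC n⟩

lemma not_tendsto_norm_atTop_of_isHypercyclicVector {T : X →L[ℝ] X} {x : X}
    (hx : x ≠ 0 → IsHypercyclicVector T x) : ¬ Tendsto (fun n => ‖(T ^ n) x‖) atTop atTop := by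
  intro h
  have hx0 : x ≠ 0 := by
    rintro rfl
    simp only [map_zero, norm_zero] at h
    exact not_tendsto_const_atTop 0 atTop h
  have : Nontrivial X := ⟨x, 0, hx0⟩
  have hneBot : ∀ x : X, (𝓝[≠] x).NeBot := fun x => Module.punctured_nhds_neBot ℝ _ x
  have hd : DenseRange fun n => (T ^ n) x := hx hx0
  obtain ⟨n, hn, hn'⟩ := ((frequently_mem_of_denseRange hd Metric.isOpen_ball
    ⟨0, Metric.mem_ball_self one_pos⟩).and_eventually (h.eventually_ge_atTop 1)).exists
  rw [mem_ball_zero_iff] at hn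
  linarith

lemma not_tendsto_norm_atTop_of_isRecurrentVector {T : X →L[ℝ] X} {x : X}
    (hx : IsRecurrentVector T x) : ¬ Tendsto (fun n => ‖(T ^ n) x‖) atTop atTop := by
  obtain ⟨k, hk, hkx⟩ := hx
  exact fun h => not_tendsto_nhds_of_tendsto_atTop (h.comp hk.tendsto_atTop) _ hkx.norm

lemma not_tendsto_norm_atTop_of_bddAbove {T : X →L[ℝ] X} {E : Submodule ℝ X} {l : ℕ → ℕ}
    (hl : StrictMono l) (h : BddAbove (Set.range fun n => ‖(T ^ l n).comp E.subtypeL‖)) {x : X}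
    (hx : x ∈ E) : ¬ Tendsto (fun n => ‖(T ^ n) x‖) atTop atTop := by
  obtain ⟨M, hM⟩ := h
  intro ht
  obtain ⟨n, hn⟩ := ((ht.comp hl.tendsto_atTop).eventually_gt_atTop (M * ‖x‖)).exists
  refine absurd hn (not_lt.2 ?_)
  exact ((T ^ l n).comp E.subtypeL).le_of_opNorm_le (hM ⟨n, rfl⟩) ⟨x, hx⟩

variable [CompleteSpace X]

/-- A point z of the closed disc is approached by (1 - t)z, of modulus below one, where the absence
of eigenfunctionals gives dense range. -/
lemma exists_bounded_approx_of_mem_essentialSpectrum {T : X →L[ℝ] X}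
    (hT : (essentialSpectrum (Complexification.map T) ∩ Metric.closedBall (0 : ℂ) 1).Nonempty)
    (hg : ∀ c : ℂ, ‖c‖ < 1 → ∀ g : X →L[ℝ] ℂ, (∀ x, g (T x) = c * g x) → g = 0) :
    ∃ (C : ℝ) (L : ℕ → X →L[ℝ] X), (∀ m, ‖L m‖ ≤ C) ∧
      ∀ s : Set (StrongDual ℝ X), s.Finite → ∀ (n : ℕ), ∀ ε > 0,
        ∃ x, ‖x‖ = 1 ∧ (∀ f ∈ s, f x = 0) ∧ ∀ m ≤ n, ‖(T ^ m) x - L m x‖ ≤ ε := by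
  obtain ⟨z, hz, hz1⟩ := hT
  rw [mem_closedBall_zero_iff] at hz1
  refine exists_bounded_approx_of_approx_eigenvector hz1 fun s hs ε hε =>
    exists_approx_eigenvector_of_mem_essentialSpectrum hz (fun δ hδ => ?_) hs hε
  obtain ⟨t, ht0, htδ, ht1⟩ : ∃ t : ℝ, 0 < t ∧ t < δ ∧ t < 1 := by
    obtain ⟨t, ht0, ht⟩ := exists_between (lt_min hδ one_pos)
    exact ⟨t, ht0, ht.trans_le (min_le_left _ _), ht.trans_le (min_le_right _ _)⟩
  refine ⟨((1 - t : ℝ) : ℂ) * z, ?_, denseRange_map_sub_of_forall_eq_zero (hg _ ?_)⟩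
  · have : ((1 - t : ℝ) : ℂ) * z - z = -((t : ℂ) * z) := by push_cast; ring
    rw [this, norm_neg, norm_mul, Complex.norm_of_nonneg ht0.le]
    exact (mul_le_of_le_one_right ht0.le hz1).trans_lt htδ
  · rw [norm_mul, Complex.norm_of_nonneg (by linarith)]
    exact (mul_le_of_le_one_right (by linarith) hz1).trans_lt (by linarith)

theorem IsWeaklyMixing.exists_tendsto_zero_and_hasHypercyclicSubspace
    [TopologicalSpace.SeparableSpace X] {T : X →L[ℝ] X} (hT : IsWeaklyMixing T)
    (hess : (essentialSpectrum (Complexification.map T) ∩ Metric.closedBall (0 : ℂ) 1).Nonempty) :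
    (∃ E : Submodule ℝ X, IsInfDimClosed E ∧ ∃ l : ℕ → ℕ, StrictMono l ∧
      ∀ x ∈ E, Tendsto (fun n => (T ^ l n) x) atTop (𝓝 0)) ∧ HasHypercyclicSubspace T := by
  obtain ⟨C, L, hL, happrox⟩ := exists_bounded_approx_of_mem_essentialSpectrum hess
    fun c hc g hg => hT.isHypercyclic.eigenfunctional_eq_zero hc hg
  have : Nontrivial X := by
    obtain ⟨x, hx, -⟩ := happrox ∅ Set.finite_empty 0 1 one_pos
    exact ⟨x, 0, fun h => by simp [h] at hx⟩
  obtain ⟨k, w, hk, hw, hw0, hwv⟩ := hT.exists_criterion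
  -- The criterion survives passing to the subsequence k ∘ p, so it holds along the same powers that
  -- vanish on E.
  obtain ⟨E, hE, p, hp, hEp⟩ := exists_isInfDimClosed_tendsto (A := 0) hL happrox hw hk
    (by rintro _ ⟨j, rfl⟩; exact hw0 j)
  refine ⟨⟨E, hE, k ∘ p, hk.comp hp, hEp⟩, hasHypercyclicSubspace_of_criterion (l := k ∘ p) hw
    (fun j => (hw0 j).comp hp.tendsto_atTop) (fun j => ?_) hE hEp⟩
  obtain ⟨v, hv0, hv⟩ := hwv j
  exact ⟨v ∘ p, hv0.comp hp.tendsto_atTop, hv.comp hp.tendsto_atTop⟩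

theorem IsQuasiRigid.exists_tendsto_self {T : X →L[ℝ] X} (hT : IsQuasiRigid T)
    (hess : (essentialSpectrum (Complexification.map T) ∩ Metric.closedBall (0 : ℂ) 1).Nonempty) :
    ∃ E : Submodule ℝ X, IsInfDimClosed E ∧ ∃ l : ℕ → ℕ, StrictMono l ∧
      ∀ x ∈ E, Tendsto (fun n => (T ^ l n) x) atTop (𝓝 x) := by
  obtain ⟨C, L, hL, happrox⟩ := exists_bounded_approx_of_mem_essentialSpectrum hess
    fun c hc g hg => hT.eigenfunctional_eq_zero hc hg
  obtain ⟨k, hk, Y, hY, hkY⟩ := hT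
  obtain ⟨E, hE, p, hp, hEp⟩ := exists_isInfDimClosed_tendsto
    (A := ContinuousLinearMap.id ℝ X) hL happrox hY hk hkY
  exact ⟨E, hE, k ∘ p, hk.comp hp, hEp⟩

end Equivalences

end LinDyn

end

theorem mainTheorem4 {X : Type*} [NormedAddCommGroup X] [NormedSpace ℝ X] [CompleteSpace X]
    [TopologicalSpace.SeparableSpace X] (T : X →L[ℝ] X) :
    (LinDyn.IsWeaklyMixing T →
      List.TFAE [
        LinDyn.HasHypercyclicSubspace T,
        ∃ E : Submodule ℝ X, LinDyn.IsInfDimClosed E ∧ ∃ l : ℕ → ℕ, StrictMono l ∧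
          ∀ x ∈ E, Tendsto (fun n => (T ^ l n) x) atTop (𝓝 0),
        ∃ E : Submodule ℝ X, LinDyn.IsInfDimClosed E ∧ ∃ l : ℕ → ℕ, StrictMono l ∧
          BddAbove (Set.range fun n => ‖(T ^ l n).comp E.subtypeL‖),
        (LinDyn.essentialSpectrum (LinDyn.Complexification.map T) ∩
          Metric.closedBall (0 : ℂ) 1).Nonempty]) ∧
    (LinDyn.IsQuasiRigid T →
      List.TFAE [
        LinDyn.HasRecurrentSubspace T,
        ∃ E : Submodule ℝ X, LinDyn.IsInfDimClosed E ∧ ∃ l : ℕ → ℕ, StrictMono l ∧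
          ∀ x ∈ E, Tendsto (fun n => (T ^ l n) x) atTop (𝓝 x),
        ∃ E : Submodule ℝ X, LinDyn.IsInfDimClosed E ∧ ∃ l : ℕ → ℕ, StrictMono l ∧
          BddAbove (Set.range fun n => ‖(T ^ l n).comp E.subtypeL‖),
        (LinDyn.essentialSpectrum (LinDyn.Complexification.map T) ∩
          Metric.closedBall (0 : ℂ) 1).Nonempty]) := by
  refine ⟨fun hT => ?_, fun hT => ?_⟩
  · tfae_have 4 → 1 := fun h => (hT.exists_tendsto_zero_and_hasHypercyclicSubspace h).2
    tfae_have 4 → 2 := fun h => (hT.exists_tendsto_zero_and_hasHypercyclicSubspace h).1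
    tfae_have 2 → 3 := fun ⟨E, hE, l, hl, h⟩ =>
      ⟨E, hE, l, hl, LinDyn.bddAbove_range_norm_comp_subtypeL hE.1 h⟩
    tfae_have 3 → 4 := fun ⟨E, hE, l, hl, h⟩ => by
      by_contra hess
      obtain ⟨x, hx, hlim⟩ := LinDyn.exists_mem_tendsto_norm_pow_atTop hess hE
      exact LinDyn.not_tendsto_norm_atTop_of_bddAbove hl h hx hlim
    tfae_have 1 → 4 := fun ⟨Z, hZ, h⟩ => by
      by_contra hess
      obtain ⟨x, hx, hlim⟩ := LinDyn.exists_mem_tendsto_norm_pow_atTop hess hZ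
      exact LinDyn.not_tendsto_norm_atTop_of_isHypercyclicVector (h x hx) hlim
    tfae_finish
  · tfae_have 4 → 2 := hT.exists_tendsto_self
    tfae_have 2 → 1 := fun ⟨E, hE, l, hl, h⟩ => ⟨E, hE, fun x hx => ⟨l, hl, h x hx⟩⟩
    tfae_have 2 → 3 := fun ⟨E, hE, l, hl, h⟩ =>
      ⟨E, hE, l, hl, LinDyn.bddAbove_range_norm_comp_subtypeL hE.1 h⟩
    tfae_have 3 → 4 := fun ⟨E, hE, l, hl, h⟩ => by
      by_contra hess
      obtain ⟨x, hx, hlim⟩ := LinDyn.exists_mem_tendsto_norm_pow_atTop hess hE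
      exact LinDyn.not_tendsto_norm_atTop_of_bddAbove hl h hx hlim
    tfae_have 1 → 4 := fun ⟨Z, hZ, h⟩ => by
      by_contra hess
      obtain ⟨x, hx, hlim⟩ := LinDyn.exists_mem_tendsto_norm_pow_atTop hess hZ
      exact LinDyn.not_tendsto_norm_atTop_of_isRecurrentVector (h x hx) hlim
    tfae_finish
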